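/- Let $q>1$ be real, let $a,b\in\mathbb C^*$, and for $c\in\{a,b\}$ let $E_{c,q}=\sum_{n\ge 0}(-1)^n c^{-n-1}q^{n(n-1)/2}x^n\in\mathbb C[[x]]$ be the unique formal power series solution of $x\,y(qx)+c\,y(x)=1$. Let $d\in\mathbb R$ with $d\notin\{\arg(-a)+2\pi\mathbb Z\}\cup\{\arg(-b)+2\pi\mathbb Z\}$. Notation. $\widetilde{\mathbb C}^*$ is the Riemann surface of the logarithm and, for $p>1$: (i) $\hat{\mathcal B}_{p}\big(\sum a_nx^n\big)=\sum a_n p^{-n(n-1)/2}\xi^n$ is the formal $p$-Borel transform; (ii) $\mathbb E_{p}^d$ is the space of functions $\phi$ analytic in a sector $V=\{\xi\in\widetilde{\mathbb C}^*:|\arg\xi-d|<\varepsilon\}$, $\varepsilon>0$, such that for some $A,R>0$ both $|\phi(\xi)|$ on $V\cap\{|\xi|\le R\}$ and $|\phi(\xi)|\,e^{-(\log|A\xi|)^2/(2\log p)}$ on $V\cap\{|\xi|>R\}$ are bounded; (iii) $\mathcal L_{p}^d(\phi)(x)=\frac{1}{\sqrt{2\pi\log p}}\int_0^{\infty e^{\mathbf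 i d}}e^{-(\log(\frac{x}{\sqrt p\,\xi}))^2/(2\log p)}\phi(\xi)\frac{d\xi}{\xi}$; (iv) $\mathcal C^d$ is the analytic continuation along direction $d$ of a germ at $0$. A series $f\in\mathbb C[[x]]$ belongs to $\mathbb C[[x]]_{q;1}^d$ if $\hat{\mathcal B}_{q}(f)$ converges near $0$ and $\phi=\mathcal C^d\hat{\mathcal B}_q(f)$ exists and lies in $\mathbb E_{q}^d$; its sum is then $\mathcal S_{q;1}^d(f)=\mathcal L_{q}^d(\phi)$. It belongs to $\mathbb C[[x]]_{q;(1,2)}^d$ if $\hat{\mathcal B}_{q}(f)$ converges near $0$, $\phi_1=\mathcal C^d\hat{\mathcal B}_q(f)$ exists and lies in $\mathbb E_{q^{1/2}}^d$, and $\phi_2=\mathcal C^d\mathcal L_{q^{1/2}}^d(\phi_1)$ exists and lies in $\mathbb E_{q^{1/2}}^d$; its $(1,2)$-multisum is then $\mathcal S_{q;(1,2)}^d(f)=\mathcal L_{q^{1/2}}^d(\phi_2)$. Theorem. $E_{a,q}$ and $E_{b,q}$ belong to $\mathbb C[[x]]_{q;1}^d$, the product $E_{a,q}E_{b,q}$ belongs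 to $\mathbb C[[x]]_{q;(1,2)}^d$, and for all $x\in\widetilde{\mathbb C}^*$ the integrals defining the three sums below converge absolutely at $x$ and $$\mathcal S_{q;(1,2)}^d(E_{a,q}E_{b,q})(x)=\mathcal S_{q;1}^d(E_{a,q})(x)\,\mathcal S_{q;1}^d(E_{b,q})(x).$$ -/

import Mathlib

open Set
open scoped PowerSeries

/-- The Riemann surface of the logarithm (the universal covering of `ℂ \ {0}`), described by its
global holomorphic coordinate `log`: the complex number `w` stands for the point of modulus
`exp (re w)` and argument `im w`. A function on the surface is holomorphic if and only if it is
holomorphic in this coordinate. -/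
abbrev LogSurface : Type := ℂ

namespace LogSurface

/-- The covering map onto `ℂ \ {0}`. -/
noncomputable def proj (w : LogSurface) : ℂ := Complex.exp w

/-- The modulus `|x|` of a point of the surface. -/
noncomputable def modulus (w : LogSurface) : ℝ := Real.exp w.re

/-- The argument of a point of the surface, a real number (not taken modulo `2π`). -/
def argument (w : LogSurface) : ℝ := w.im

/-- The point of modulus `exp t` on the half line of direction `d`. -/
noncomputable def ray (d t : ℝ) : LogSurface := (t : ℂ) + (d : ℂ) * Complex.I

end LogSurface

/-- The disc `|x| < R` of the surface. -/
def logDisc (R : ℝ) : Set LogSurface := {x | x.modulus < R}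

/-- The open sector `|arg ξ - d| < ε` of the surface. -/
def logSector (d ε : ℝ) : Set LogSurface := {ξ | |ξ.argument - d| < ε}

/-- `q ^ (1 / k) = exp (log q / k)`. -/
noncomputable def qRoot (q : ℝ) (k : ℚ) : ℝ := Real.exp (Real.log q / (k : ℝ))

/-- The formal `q`-Borel transform of order one,
`∑ a_n x ^ n ↦ ∑ a_n q ^ (-n (n - 1) / 2) ξ ^ n`. -/
noncomputable def formalBorel (q : ℝ) (f : ℂ⟦X⟧) : ℂ⟦X⟧ :=
  PowerSeries.mk fun n => PowerSeries.coeff n f * ((q : ℂ) ^ (n * (n - 1) / 2))⁻¹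

/-- The power series has a positive radius of convergence. -/
def IsConvergent (f : ℂ⟦X⟧) : Prop :=
  ∃ r : ℝ, 0 < r ∧ Summable fun n : ℕ => ‖PowerSeries.coeff n f‖ * r ^ n

/-- The germ at `0` defined by a convergent power series, as a function on the surface (it is
meaningful at points of small modulus only). -/
noncomputable def germOf (f : ℂ⟦X⟧) (ξ : LogSurface) : ℂ :=
  ∑' n : ℕ, PowerSeries.coeff n f * ξ.proj ^ n

/-- The space of analytic functions on a sector around direction `d`, bounded near `0` and with
`q`-exponential growth of order one at infinity. -/
def qExpGrowth (q d : ℝ) : Set (LogSurface → ℂ) :=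
  {φ | ∃ ε : ℝ, 0 < ε ∧ DifferentiableOn ℂ φ (logSector d ε) ∧
    ∃ A R M : ℝ, 0 < A ∧ 0 < R ∧
      (∀ ξ ∈ logSector d ε, ξ.modulus ≤ R → ‖φ ξ‖ ≤ M) ∧
      (∀ ξ ∈ logSector d ε, R < ξ.modulus →
        ‖φ ξ‖ * Real.exp (-(Real.log (A * ξ.modulus)) ^ 2 / (2 * Real.log q)) ≤ M)}

/-- The integrand `exp (-(log (x / (√q ξ))) ^ 2 / (2 log q)) φ(ξ)` of the `q`-Laplace transform at
`x`, along `ξ = exp (t + i d)`, for which `dξ / ξ = dt`. -/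
noncomputable def laplaceIntegrand (q d : ℝ) (φ : LogSurface → ℂ) (x : LogSurface) (t : ℝ) : ℂ :=
  Complex.exp (-(x - (Real.log (Real.sqrt q) : ℂ) - LogSurface.ray d t) ^ 2
    / (2 * (Real.log q : ℂ))) * φ (LogSurface.ray d t)

/-- The `q`-Laplace transform of order one in direction `d`. -/
noncomputable def qLaplace (q d : ℝ) (φ : LogSurface → ℂ) (x : LogSurface) : ℂ :=
  ((1 / Real.sqrt (2 * Real.pi * Real.log q) : ℝ) : ℂ) * ∫ t : ℝ, laplaceIntegrand q d φ x t

/-- `φ` is the analytic continuation along direction `d` of the germ at `0` given by `g`: it is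
analytic in a sector around `d` and equal to `g` at the points of small modulus there. -/
def IsContinuation (d : ℝ) (g φ : LogSurface → ℂ) : Prop :=
  ∃ ε R : ℝ, 0 < ε ∧ 0 < R ∧ DifferentiableOn ℂ φ (logSector d ε) ∧
    ∀ ξ ∈ logSector d ε ∩ logDisc R, φ ξ = g ξ

/-- Two continuations of the same germ agree in a sector around direction `d`. -/
theorem IsContinuation.unique {d : ℝ} {g φ ψ : LogSurface → ℂ}
    (hφ : IsContinuation d g φ) (hψ : IsContinuation d g ψ) :
    ∃ ε : ℝ, 0 < ε ∧ EqOn φ ψ (logSector d ε) := by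
  obtain ⟨ε₁, R₁, hε₁, hR₁, hd₁, he₁⟩ := hφ
  obtain ⟨ε₂, R₂, hε₂, hR₂, hd₂, he₂⟩ := hψ
  have key : ∀ ε : ℝ, logSector d ε = Complex.im ⁻¹' Ioo (d - ε) (d + ε) := by
    intro ε
    ext w
    simp only [logSector, LogSurface.argument, mem_ofPred_eq, mem_preimage, mem_Ioo, abs_lt]
    constructor <;> rintro ⟨h1, h2⟩ <;> constructor <;> linarith
  have hopen : ∀ ε : ℝ, IsOpen (logSector d ε) := by
    intro ε
    rw [key]
    exact isOpen_Ioo.preimage Complex.continuous_im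
  refine ⟨min ε₁ ε₂, lt_min hε₁ hε₂, ?_⟩
  have hs₁ : logSector d (min ε₁ ε₂) ⊆ logSector d ε₁ :=
    fun w hw => show |w.im - d| < ε₁ from
      lt_of_lt_of_le (show |w.im - d| < min ε₁ ε₂ from hw) (min_le_left _ _)
  have hs₂ : logSector d (min ε₁ ε₂) ⊆ logSector d ε₂ :=
    fun w hw => show |w.im - d| < ε₂ from
      lt_of_lt_of_le (show |w.im - d| < min ε₁ ε₂ from hw) (min_le_right _ _)
  have hconv : IsPreconnected (logSector d (min ε₁ ε₂)) := by
    rw [key]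
    have hc : Convex ℝ (Complex.imLm ⁻¹' Ioo (d - min ε₁ ε₂) (d + min ε₁ ε₂)) :=
      (convex_Ioo _ _).linear_preimage _
    exact hc.isPreconnected
  set z₀ : ℂ := ((Real.log (min R₁ R₂) - 1 : ℝ) : ℂ) + (d : ℂ) * Complex.I with hz₀
  have hre : z₀.re = Real.log (min R₁ R₂) - 1 := by simp [hz₀]
  have him : z₀.im = d := by simp [hz₀]
  have hzs : z₀ ∈ logSector d (min ε₁ ε₂) := by
    simp only [logSector, LogSurface.argument, mem_ofPred_eq, him, sub_self, abs_zero]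
    exact lt_min hε₁ hε₂
  have hzd : z₀ ∈ logDisc (min R₁ R₂) := by
    simp only [logDisc, LogSurface.modulus, mem_ofPred_eq, hre]
    calc Real.exp (Real.log (min R₁ R₂) - 1) < Real.exp (Real.log (min R₁ R₂)) :=
          Real.exp_lt_exp.mpr (by linarith)
      _ = min R₁ R₂ := Real.exp_log (lt_min hR₁ hR₂)
  have hdopen : IsOpen (logDisc (min R₁ R₂)) := by
    have : Continuous fun w : ℂ => Real.exp w.re := by fun_prop
    exact isOpen_lt this continuous_const
  refine AnalyticOnNhd.eqOn_of_preconnected_of_eventuallyEq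
    ((hd₁.mono hs₁).analyticOnNhd (hopen _)) ((hd₂.mono hs₂).analyticOnNhd (hopen _))
    hconv hzs ?_
  filter_upwards [(hopen _).mem_nhds hzs, hdopen.mem_nhds hzd] with w hw hw'
  rw [he₁ w ⟨hs₁ hw, show Real.exp w.re < R₁ from
      lt_of_lt_of_le (show Real.exp w.re < min R₁ R₂ from hw') (min_le_left _ _)⟩,
    he₂ w ⟨hs₂ hw, show Real.exp w.re < R₂ from
      lt_of_lt_of_le (show Real.exp w.re < min R₁ R₂ from hw') (min_le_right _ _)⟩]

open Classical in
/-- The analytic continuation of the germ `g` along direction `d`; its values in a sector around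
direction `d` are determined as soon as a continuation exists. -/
noncomputable def continuation (d : ℝ) (g : LogSurface → ℂ) : LogSurface → ℂ :=
  if h : ∃ φ, IsContinuation d g φ then Classical.choose h else 0

/-- The nonempty strictly increasing finite sequences of positive rational numbers. -/
def IsOrderSeq (s : List ℚ) : Prop :=
  s ≠ [] ∧ (∀ k ∈ s, 0 < k) ∧ s.Pairwise (· < ·)

/-- The sequence `1 / (1 / s_i - 1 / s_(i+1))`, with `s_(r+1) = ∞`. -/
def tildeSeq : List ℚ → List ℚ
  | [] => []
  | [s] => [s]
  | s :: t :: l => 1 / (1 / s - 1 / t) :: tildeSeq (t :: l)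

/-- All iterated `q`-Laplace transforms of orders `k_1, k_2, …` in direction `d` of the germ `g`
can be formed: `g` continues to a function with `q`-exponential growth of order `k_1` in
direction `d`, the Laplace transform of order `k_1` of this continuation is a germ that continues
to a function with `q`-exponential growth of order `k_2`, and so on. -/
def LaplaceAdmissible (q d : ℝ) : List ℚ → (LogSurface → ℂ) → Prop
  | [], _ => True
  | k :: ks, g =>
      (∃ φ, IsContinuation d g φ ∧ φ ∈ qExpGrowth (qRoot q k) d) ∧
        LaplaceAdmissible q d ks (qLaplace (qRoot q k) d (continuation d g))

/-- The iterated `q`-Laplace transform of orders `k_1, k_2, …` (first `k_1`), each one applied to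
the continuation in direction `d` of the preceding germ. -/
noncomputable def iterLaplace (q d : ℝ) : List ℚ → (LogSurface → ℂ) → (LogSurface → ℂ)
  | [], g => g
  | k :: ks, g => iterLaplace q d ks (qLaplace (qRoot q k) d (continuation d g))

/-- The last one of the iterated `q`-Laplace integrals converges absolutely at the point `x`. -/
def IterLaplaceConverges (q d : ℝ) : List ℚ → (LogSurface → ℂ) → LogSurface → Prop
  | [], _, _ => True
  | [k], g, x =>
      MeasureTheory.Integrable (laplaceIntegrand (qRoot q k) d (continuation d g) x)
  | k :: k' :: ks, g, x =>
      IterLaplaceConverges q d (k' :: ks) (qLaplace (qRoot q k) d (continuation d g)) x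

/-- The formal `q`-Borel transform of order `s_1`. -/
noncomputable def firstBorel (q : ℝ) (s : List ℚ) (f : ℂ⟦X⟧) : ℂ⟦X⟧ :=
  formalBorel (qRoot q (s.headD 1)) f

/-- The power series that are `q`-multisummable of order `s = (s_1, …, s_r)` in direction `d`. -/
def qMultisummable (q d : ℝ) (s : List ℚ) : Set ℂ⟦X⟧ :=
  {f | IsOrderSeq s ∧ IsConvergent (firstBorel q s f) ∧
    LaplaceAdmissible q d (tildeSeq s) (germOf (firstBorel q s f))}

/-- The `q`-multisum of order `s` of `f` in direction `d`, a function on the Riemann surface of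
the logarithm. -/
noncomputable def qMultisum (q d : ℝ) (s : List ℚ) (f : ℂ⟦X⟧) : LogSurface → ℂ :=
  iterLaplace q d (tildeSeq s) (germOf (firstBorel q s f))

/-- The integral that defines the `q`-multisum of `f` converges absolutely at `x`. -/
def QMultisumConverges (q d : ℝ) (s : List ℚ) (f : ℂ⟦X⟧) (x : LogSurface) : Prop :=
  IterLaplaceConverges q d (tildeSeq s) (germOf (firstBorel q s f)) x

/-- The `q`-difference operator `(σ_q y)(x) = y(q x)` on formal power series. -/
noncomputable def sigmaQ (q : ℝ) (y : ℂ⟦X⟧) : ℂ⟦X⟧ := PowerSeries.rescale (q : ℂ) y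

/-- The `q`-Euler type series `∑ (-1) ^ n a ^ (-n - 1) q ^ (n (n - 1) / 2) x ^ n`. -/
noncomputable def qEuler (q : ℝ) (a : ℂ) : ℂ⟦X⟧ :=
  PowerSeries.mk fun n => (-1) ^ n * (a ^ (n + 1))⁻¹ * (q : ℂ) ^ (n * (n - 1) / 2)

/-- `qEuler q a` is the unique formal solution of `(x σ_q + a) y = 1`. -/
theorem qEuler_iff (q : ℝ) {a : ℂ} (ha : a ≠ 0) (y : ℂ⟦X⟧) :
    PowerSeries.X * sigmaQ q y + PowerSeries.C a * y = 1 ↔ y = qEuler q a := by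
  have hq : ∀ n : ℕ, (n + 1) * (n + 1 - 1) / 2 = n * (n - 1) / 2 + n := by
    intro n
    have h := Nat.triangle_succ n
    simpa using h
  constructor
  · intro h
    have h0 : ∀ n, PowerSeries.coeff n y
        = (-1) ^ n * (a ^ (n + 1))⁻¹ * (q : ℂ) ^ (n * (n - 1) / 2) := by
      intro n
      induction n with
      | zero =>
        have h1 := congrArg (PowerSeries.coeff 0) h
        simp only [map_add, PowerSeries.coeff_zero_X_mul, PowerSeries.coeff_C_mul, zero_add,
          PowerSeries.coeff_one, if_true] at h1
        simp only [pow_zero, zero_add, pow_one, one_mul, Nat.zero_mul, Nat.zero_div, mul_one]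
        field_simp
        linear_combination h1
      | succ n ih =>
        have h1 := congrArg (PowerSeries.coeff (n + 1)) h
        simp only [map_add, PowerSeries.coeff_succ_X_mul, PowerSeries.coeff_C_mul, sigmaQ,
          PowerSeries.coeff_rescale, PowerSeries.coeff_one, Nat.succ_ne_zero, if_false] at h1
        rw [ih] at h1
        rw [hq, pow_add (q : ℂ)]
        apply mul_left_cancel₀ ha
        rw [eq_neg_of_add_eq_zero_right h1]
        field_simp
        ring
    ext n
    rw [h0, qEuler, PowerSeries.coeff_mk]
  · rintro rfl
    ext n
    cases n with
    | zero =>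
      simp [qEuler, ha]
    | succ n =>
      simp only [map_add, PowerSeries.coeff_succ_X_mul, PowerSeries.coeff_C_mul, sigmaQ,
        PowerSeries.coeff_rescale, PowerSeries.coeff_one, Nat.succ_ne_zero, if_false, qEuler,
        PowerSeries.coeff_mk]
      rw [hq, pow_add (q : ℂ)]
      field_simp
      ring

/-! Put `p = q^(1/2)` and `σ = log p`, and work in the coordinate `w = log ξ`, where a `q`-Laplace
transform is convolution with a Gaussian. The Borel transform of `E_a` is `1 / (a + ξ)`, bounded on
a sector around `d` that avoids the argument of `-a`; so each factor is summed by one Gaussian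
integral of variance `2σ`.

For the product, the Borel transform has coefficients `∑ A^i B^j q^(-ij)` up to a constant, with `A
= -1/a`, `B = -1/b`. Splitting off the end terms gives a `q`-difference equation; iterating it
towards `0` gives `∑ q^(-n²) ξ^(2n) (ab)^(-n) P(q^(-n) ξ)` with `P = a/(a+ξ) + b/(b+ξ) - 1`. This
theta-like series converges on the whole sector and has `p`-exponential growth
(`const_mul_borelSum_mem_qExpGrowth`).

Under the first Laplace transform, completing the square turns the `n`-th term into `r^n` times a
translate of the `0`-th, where `r = e^(2w-σ) / (ab)`. For small `|r|` the transform is therefore the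
Gaussian integral of `P` divided by `1 - r`. The identity `(1 - αβ) / ((1+α)(1+β)) = 1/(1+α) +
1/(1+β) - 1` with `αβ = r` rewrites it as `crossIntegral`, in which the apparent pole at `r = 1` is
gone. That integral is analytic and bounded on the sector, hence is the required continuation.

The second Laplace transform is then a double Gaussian integral in `(u, v)`; the rotation `s = u +
v`, `t = u - v` splits it into the product of the two sums
(`integral_gaussKer_mul_integral_gaussKer`). -/

/-! ### Sectors in the logarithmic coordinate -/

theorem isOpen_logSector (d ε : ℝ) : IsOpen (logSector d ε) := by
  have : Continuous fun w : ℂ => |w.im - d| := by fun_prop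
  exact isOpen_lt this continuous_const

theorem convex_logSector (d ε : ℝ) : Convex ℝ (logSector d ε) := by
  have key : logSector d ε = Complex.imLm ⁻¹' Ioo (d - ε) (d + ε) := by
    ext w
    change |w.im - d| < ε ↔ w.im ∈ Ioo (d - ε) (d + ε)
    rw [abs_lt, mem_Ioo]
    constructor <;> rintro ⟨h1, h2⟩ <;> constructor <;> linarith
  rw [key]
  exact (convex_Ioo _ _).linear_preimage _

theorem logSector_mono {d ε δ : ℝ} (h : ε ≤ δ) : logSector d ε ⊆ logSector d δ :=
  fun _ hw => lt_of_lt_of_le hw h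

theorem ray_mem_logSector {d ε : ℝ} (hε : 0 < ε) (t : ℝ) : LogSurface.ray d t ∈ logSector d ε := by
  simpa [logSector, LogSurface.argument, LogSurface.ray] using hε

theorem add_ofReal_mem_logSector {d ε : ℝ} {w : ℂ} (hw : w ∈ logSector d ε) (t : ℝ) :
    w + (t : ℂ) ∈ logSector d ε := by
  simpa [logSector, LogSurface.argument] using hw

theorem sub_ofReal_mem_logSector {d ε : ℝ} {w : ℂ} (hw : w ∈ logSector d ε) (t : ℝ) :
    w - (t : ℂ) ∈ logSector d ε := by
  simpa [logSector, LogSurface.argument] using hw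

/-! ### The simple pole on a sector avoiding it -/

/-- The function `a / (a + ξ)` in the logarithmic coordinate. -/
noncomputable def eulerPole (a w : ℂ) : ℂ := (1 + Complex.exp w / a)⁻¹

theorem normSq_one_sub_exp (z : ℂ) :
    Complex.normSq (1 - Complex.exp z)
      = 1 - 2 * Real.exp z.re * Real.cos z.im + Real.exp z.re ^ 2 := by
  rw [Complex.normSq_apply]
  simp only [Complex.sub_re, Complex.sub_im, Complex.one_re, Complex.one_im, Complex.exp_re,
    Complex.exp_im]
  linear_combination Real.exp z.re ^ 2 * Real.sin_sq_add_cos_sq z.im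

theorem one_add_exp_div_eq {a : ℂ} (ha : a ≠ 0) (w : ℂ) :
    1 + Complex.exp w / a = 1 - Complex.exp (w - Complex.log (-a)) := by
  rw [Complex.exp_sub, Complex.exp_log (neg_ne_zero.mpr ha), div_neg]
  ring

/-- With `ρ = |ξ/a|` and `θ` the angle from `-a`, `|1 + ξ/a|² = 1 - 2ρ cos θ + ρ²`. If `cos θ < κ`
this is at least `(ρ - κ)² + 1 - κ²`, a bound uniform in the modulus of `ξ`. -/
theorem exists_eulerPole_bound {a : ℂ} (ha : a ≠ 0) {d : ℝ}
    (hd : ∀ k : ℤ, d ≠ (-a).arg + 2 * Real.pi * k) :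
    ∃ ε C : ℝ, 0 < ε ∧ 0 < C ∧
      ∀ w ∈ logSector d ε, 1 + Complex.exp w / a ≠ 0 ∧ ‖eulerPole a w‖ ≤ C := by
  have hlt : Real.cos (d - (-a).arg) < 1 := by
    refine lt_of_le_of_ne (Real.cos_le_one _) fun h => ?_
    obtain ⟨k, hk⟩ := (Real.cos_eq_one_iff _).mp h
    exact hd k (by linarith)
  -- The maximum with `0` forces `0 < κ < 1`, so that `1 - κ² > 0`.
  obtain ⟨κ, hκ, hκ1⟩ := exists_between (max_lt hlt one_pos)
  have hκ0 : 0 < κ := lt_of_le_of_lt (le_max_right _ _) hκ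
  have hc : ∀ᶠ y in nhds d, Real.cos (y - (-a).arg) < κ := by
    have : ContinuousAt (fun y : ℝ => Real.cos (y - (-a).arg)) d := by fun_prop
    exact this.eventually_lt continuousAt_const (lt_of_le_of_lt (le_max_left _ _) hκ)
  obtain ⟨ε, hε, hball⟩ := Metric.eventually_nhds_iff.mp hc
  have hpos : 0 < 1 - κ ^ 2 := by nlinarith
  refine ⟨ε, (Real.sqrt (1 - κ ^ 2))⁻¹, hε, by positivity, fun w hw => ?_⟩
  have hcos : Real.cos (w - Complex.log (-a)).im < κ := by
    rw [Complex.sub_im, Complex.log_im]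
    exact hball (by rw [Real.dist_eq]; exact hw)
  have hns : 1 - κ ^ 2 ≤ Complex.normSq (1 + Complex.exp w / a) := by
    rw [one_add_exp_div_eq ha, normSq_one_sub_exp]
    nlinarith [Real.exp_pos (w - Complex.log (-a)).re,
      sq_nonneg (Real.exp (w - Complex.log (-a)).re - κ)]
  constructor
  · intro h0
    rw [h0, map_zero] at hns
    linarith
  · rw [eulerPole, norm_inv]
    refine inv_anti₀ (by positivity) ?_
    rw [Complex.norm_def]
    exact Real.sqrt_le_sqrt hns

/-! ### Holomorphic parameter integrals -/

/-- Differentiation under the integral sign for locally dominated families of holomorphic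
functions. -/
theorem differentiableOn_integral_of_locally_dominated {α : Type*} [MeasurableSpace α]
    {μ : MeasureTheory.Measure α} {U : Set ℂ} (hU : IsOpen U) {F : ℂ → α → ℂ}
    (hdiff : ∀ t, DifferentiableOn ℂ (fun z => F z t) U)
    (hmeas : ∀ z ∈ U, MeasureTheory.AEStronglyMeasurable (F z) μ)
    (hbound : ∀ z ∈ U, ∃ g : α → ℝ, MeasureTheory.Integrable g μ ∧
      ∀ᶠ y in nhds z, ∀ t, ‖F y t‖ ≤ g t) :
    DifferentiableOn ℂ (fun z => ∫ t, F z t ∂μ) U := by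
  intro z hz
  obtain ⟨g, hg, hev⟩ := hbound z hz
  obtain ⟨r, hr, hball⟩ := Metric.eventually_nhds_iff.mp (hev.and (hU.mem_nhds hz))
  have hballU : ∀ y, dist y z < r → y ∈ U := fun y hy => (hball hy).2
  have hderivAt : ∀ t, ∀ y, dist y z < r → HasDerivAt (fun z => F z t)
      (deriv (fun z => F z t) y) y := fun t y hy =>
    ((hdiff t).differentiableAt (hU.mem_nhds (hballU y hy))).hasDerivAt
  have hz0 : dist z z < r := by simpa using hr
  -- The derivative is a pointwise limit of measurable difference quotients along a sequence of
  -- steps shorter than `r`.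
  have hmeas' : MeasureTheory.AEStronglyMeasurable (fun t => deriv (fun z => F z t) z) μ := by
    set u : ℕ → ℂ := fun n => ((r / 2 / (n + 1) : ℝ) : ℂ) with hu
    have hupos : ∀ n : ℕ, 0 < r / 2 / ((n : ℝ) + 1) := fun n => by positivity
    have hun : ∀ n, dist (z + u n) z < r := by
      intro n
      rw [dist_eq_norm, add_sub_cancel_left, hu, Complex.norm_real, Real.norm_eq_abs,
        abs_of_pos (hupos n)]
      calc r / 2 / ((n : ℝ) + 1) ≤ r / 2 :=
            div_le_self (by positivity) (by linarith [(Nat.cast_nonneg n : (0 : ℝ) ≤ n)])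
        _ < r := by linarith
    have hlim : Filter.Tendsto u Filter.atTop (nhdsWithin 0 {0}ᶜ) := by
      refine tendsto_nhdsWithin_iff.mpr ⟨?_, Filter.Eventually.of_forall fun n => ?_⟩
      · have h1 : Filter.Tendsto (fun n : ℕ => r / 2 / ((n : ℝ) + 1)) Filter.atTop (nhds 0) :=
          tendsto_const_nhds.div_atTop
            (Filter.tendsto_atTop_add_const_right _ _ tendsto_natCast_atTop_atTop)
        have h2 := (Complex.continuous_ofReal.tendsto 0).comp h1
        simpa [hu, Function.comp_def] using h2
      · simp only [hu, mem_compl_iff, mem_singleton_iff, Complex.ofReal_eq_zero]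
        exact (hupos n).ne'
    refine aestronglyMeasurable_of_tendsto_ae Filter.atTop
      (f := fun n t => (u n)⁻¹ • (F (z + u n) t - F z t)) (fun n => ?_)
      (Filter.Eventually.of_forall fun t => ?_)
    · exact ((hmeas _ (hballU _ (hun n))).sub (hmeas z hz)).const_smul (u n)⁻¹
    · exact ((hderivAt t z hz0).tendsto_slope_zero).comp hlim
  -- Circles of radius `r/4` about points of the `r/2`-ball stay in the `r`-ball, where `g`
  -- dominates; Cauchy's estimate bounds the derivative by `g / (r/4)`.
  have key := hasDerivAt_integral_of_dominated_loc_of_deriv_le (μ := μ) (F := F) (x₀ := z)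
    (s := Metric.ball z (r / 2)) (bound := fun t => g t / (r / 4))
    (F' := fun y t => deriv (fun z => F z t) y) (Metric.ball_mem_nhds _ (by positivity))
    (by
      filter_upwards [hU.mem_nhds hz] with y hy
      exact hmeas y hy)
    (hg.mono' (hmeas z hz) (Filter.Eventually.of_forall fun t => (hball hz0).1 t))
    hmeas'
    (Filter.Eventually.of_forall fun t y hy => by
      rw [Metric.mem_ball] at hy
      have hsub : ∀ v, dist v y ≤ r / 4 → dist v z < r := fun v hv => by
        have := dist_triangle v y z
        linarith
      refine Complex.norm_deriv_le_of_forall_mem_sphere_norm_le (by positivity) ?_ ?_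
      · refine DifferentiableOn.diffContOnCl_ball (U := U) (hdiff t) fun v hv => ?_
        exact hballU v (hsub v hv)
      · intro v hv
        exact (hball (hsub v (le_of_eq hv))).1 t)
    (hg.div_const _)
    (Filter.Eventually.of_forall fun t y hy => hderivAt t y (by
      rw [Metric.mem_ball] at hy
      linarith))
  exact key.2.differentiableAt.differentiableWithinAt

theorem eulerPole_differentiableOn {a : ℂ} {s : Set ℂ}
    (h : ∀ w ∈ s, 1 + Complex.exp w / a ≠ 0) : DifferentiableOn ℂ (eulerPole a) s := by
  unfold eulerPole
  intro w hw
  have h1 : DifferentiableAt ℂ (fun w : ℂ => 1 + Complex.exp w / a) w := by fun_prop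
  exact (h1.fun_inv (h w hw)).differentiableWithinAt

/-! ### The power series of the Borel transform of the product -/

/-- The coefficients of the `q`-Borel transform of a product of two `q`-Euler series, up to a
constant factor. -/
noncomputable def borelProdCoeff (A B Q : ℂ) (n : ℕ) : ℂ :=
  ∑ p ∈ Finset.HasAntidiagonal.antidiagonal n, A ^ p.1 * B ^ p.2 * Q ^ (p.1 * p.2)

theorem borelProdCoeff_zero (A B Q : ℂ) : borelProdCoeff A B Q 0 = 1 := by
  simp [borelProdCoeff]

theorem borelProdCoeff_one (A B Q : ℂ) : borelProdCoeff A B Q 1 = A + B := by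
  simp [borelProdCoeff, Finset.Nat.antidiagonal_succ, add_comm]

/-- The two end terms give the pure powers. In the others both indices drop by one, and `(i+1)(j+1)
= ij + n + 1` for `i + j = n`. -/
theorem borelProdCoeff_add_two (A B Q : ℂ) (n : ℕ) :
    borelProdCoeff A B Q (n + 2)
      = A ^ (n + 2) + B ^ (n + 2) + A * B * Q * (Q ^ n * borelProdCoeff A B Q n) := by
  simp only [borelProdCoeff]
  rw [Finset.Nat.antidiagonal_succ_succ', Finset.sum_cons, Finset.sum_cons, Finset.sum_map,
    Finset.mul_sum, Finset.mul_sum, add_comm (A ^ (n + 2)), add_assoc]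
  congr 1
  · simp
  congr 1
  · simp
  refine Finset.sum_congr rfl fun p hp => ?_
  rw [← Finset.HasAntidiagonal.mem_antidiagonal.mp hp]
  simp only [Function.Embedding.prodMap, Function.Embedding.coeFn_mk, Prod.map_fst, Prod.map_snd,
    Nat.succ_eq_add_one]
  ring

theorem norm_borelProdCoeff_le {A B Q : ℂ} {M : ℝ} (hA : ‖A‖ ≤ M) (hB : ‖B‖ ≤ M) (hQ : ‖Q‖ ≤ 1)
    (n : ℕ) : ‖borelProdCoeff A B Q n‖ ≤ (2 * M) ^ n := by
  have hM : 0 ≤ M := (norm_nonneg A).trans hA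
  calc ‖borelProdCoeff A B Q n‖ ≤ ∑ p ∈ Finset.HasAntidiagonal.antidiagonal n, M ^ n := by
        refine norm_sum_le_of_le _ fun p hp => ?_
        rw [norm_mul, norm_mul, norm_pow, norm_pow, norm_pow, ← Finset.HasAntidiagonal.mem_antidiagonal.mp hp,
          pow_add]
        have h1 : ‖Q‖ ^ (p.1 * p.2) ≤ 1 := pow_le_one₀ (norm_nonneg _) hQ
        have h2 : ‖A‖ ^ p.1 * ‖B‖ ^ p.2 ≤ M ^ p.1 * M ^ p.2 := by gcongr
        calc ‖A‖ ^ p.1 * ‖B‖ ^ p.2 * ‖Q‖ ^ (p.1 * p.2) ≤ ‖A‖ ^ p.1 * ‖B‖ ^ p.2 * 1 := by gcongr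
          _ ≤ M ^ p.1 * M ^ p.2 := by rw [mul_one]; exact h2
    _ = (n + 1 : ℕ) * M ^ n := by simp
    _ ≤ 2 ^ n * M ^ n := by
        gcongr
        exact_mod_cast Nat.lt_two_pow_self
    _ = (2 * M) ^ n := (mul_pow _ _ _).symm

theorem norm_borelProdCoeff_mul_pow_le {A B Q z : ℂ} {M : ℝ} (hA : ‖A‖ ≤ M) (hB : ‖B‖ ≤ M)
    (hQ : ‖Q‖ ≤ 1) (hz : 2 * M * ‖z‖ ≤ 1 / 2) (n : ℕ) :
    ‖borelProdCoeff A B Q n * z ^ n‖ ≤ (1 / 2) ^ n := by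
  have hM : 0 ≤ M := (norm_nonneg A).trans hA
  rw [norm_mul, norm_pow]
  calc ‖borelProdCoeff A B Q n‖ * ‖z‖ ^ n ≤ (2 * M) ^ n * ‖z‖ ^ n := by
        gcongr
        exact norm_borelProdCoeff_le hA hB hQ n
    _ = (2 * M * ‖z‖) ^ n := (mul_pow _ _ _).symm
    _ ≤ (1 / 2) ^ n := by gcongr

theorem summable_borelProdCoeff {A B Q z : ℂ} {M : ℝ} (hA : ‖A‖ ≤ M) (hB : ‖B‖ ≤ M)
    (hQ : ‖Q‖ ≤ 1) (hz : 2 * M * ‖z‖ ≤ 1 / 2) :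
    Summable fun n => borelProdCoeff A B Q n * z ^ n :=
  Summable.of_norm_bounded summable_geometric_two
    (norm_borelProdCoeff_mul_pow_le hA hB hQ hz)

theorem norm_tsum_borelProdCoeff_le {A B Q z : ℂ} {M : ℝ} (hA : ‖A‖ ≤ M) (hB : ‖B‖ ≤ M)
    (hQ : ‖Q‖ ≤ 1) (hz : 2 * M * ‖z‖ ≤ 1 / 2) :
    ‖∑' n, borelProdCoeff A B Q n * z ^ n‖ ≤ 2 := by
  rw [← tsum_geometric_two]
  exact tsum_of_norm_bounded summable_geometric_two.hasSum
    (norm_borelProdCoeff_mul_pow_le hA hB hQ hz)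

/-- The recurrence summed over `n`: its factor `Q^n` rescales `z` to `Qz`, and the terms of index
`0` and `1`, missing from the recurrence, combine with the truncated geometric series to leave `-1`.
-/
theorem tsum_borelProdCoeff_eq {A B Q z : ℂ} {M : ℝ} (hA : ‖A‖ ≤ M) (hB : ‖B‖ ≤ M)
    (hQ : ‖Q‖ ≤ 1) (hz : 2 * M * ‖z‖ ≤ 1 / 2) :
    ∑' n, borelProdCoeff A B Q n * z ^ n
      = (1 - A * z)⁻¹ + (1 - B * z)⁻¹ - 1
        + A * B * Q * z ^ 2 * ∑' n, borelProdCoeff A B Q n * (Q * z) ^ n := by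
  have hM : 0 ≤ M := (norm_nonneg A).trans hA
  have hlt : ∀ X : ℂ, ‖X‖ ≤ M → ‖X * z‖ < 1 := fun X hX => by
    rw [norm_mul]
    have : ‖X‖ * ‖z‖ ≤ M * ‖z‖ := by gcongr
    linarith
  have hQz : 2 * M * ‖Q * z‖ ≤ 1 / 2 := by
    rw [norm_mul]
    have : ‖Q‖ * ‖z‖ ≤ 1 * ‖z‖ := by gcongr
    nlinarith
  have hgeo : ∀ X : ℂ, ‖X‖ ≤ M →
      HasSum (fun n => X ^ (n + 2) * z ^ (n + 2)) ((1 - X * z)⁻¹ - (1 + X * z)) := fun X hX => by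
    have h := (hasSum_nat_add_iff' (f := fun n => (X * z) ^ n) 2).mpr
      (hasSum_geometric_of_norm_lt_one (hlt X hX))
    simpa [Finset.sum_range_succ, mul_pow] using h
  have h3 := ((summable_borelProdCoeff hA hB hQ hQz).hasSum).mul_left (A * B * Q * z ^ 2)
  have hfun : (fun n => borelProdCoeff A B Q (n + 2) * z ^ (n + 2))
      = fun n => A ^ (n + 2) * z ^ (n + 2) + B ^ (n + 2) * z ^ (n + 2)
        + A * B * Q * z ^ 2 * (borelProdCoeff A B Q n * (Q * z) ^ n) := by
    funext n
    rw [borelProdCoeff_add_two]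
    ring
  have hsum := ((hgeo A hA).add (hgeo B hB)).add h3
  rw [← hfun] at hsum
  have h := ((hasSum_nat_add_iff (f := fun n => borelProdCoeff A B Q n * z ^ n) 2).mp hsum).tsum_eq
  rw [h]
  simp only [Finset.sum_range_succ, Finset.sum_range_zero, borelProdCoeff_zero,
    borelProdCoeff_one]
  ring

/-! ### Formal Borel transforms and their germs -/

theorem triangle_add (i j : ℕ) :
    (i + j) * (i + j - 1) / 2 = i * (i - 1) / 2 + j * (j - 1) / 2 + i * j := by
  induction j with
  | zero => simp
  | succ j ih =>
    have h1 := Nat.triangle_succ (i + j)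
    have h2 := Nat.triangle_succ j
    rw [← add_assoc, h1, ih, h2]
    ring

theorem coeff_formalBorel_qEuler {q : ℝ} (hq : q ≠ 0) (a : ℂ) (n : ℕ) :
    PowerSeries.coeff n (formalBorel q (qEuler q a)) = a⁻¹ * (-a⁻¹) ^ n := by
  have hq' : (q : ℂ) ≠ 0 := by exact_mod_cast hq
  simp only [formalBorel, qEuler, PowerSeries.coeff_mk]
  rw [mul_assoc, mul_inv_cancel₀ (pow_ne_zero _ hq'), neg_pow a⁻¹, inv_pow]
  rw [pow_succ, mul_inv]
  ring

/-- Triangular numbers are additive up to the cross term `ij`, so the Borel weight cancels the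
growth of both factors and leaves `q^(-ij)`. -/
theorem coeff_formalBorel_qEuler_mul {q : ℝ} (hq : q ≠ 0) (a b : ℂ) (n : ℕ) :
    PowerSeries.coeff n (formalBorel q (qEuler q a * qEuler q b))
      = (a * b)⁻¹ * borelProdCoeff (-a⁻¹) (-b⁻¹) (q : ℂ)⁻¹ n := by
  have hq' : (q : ℂ) ≠ 0 := by exact_mod_cast hq
  simp only [formalBorel, PowerSeries.coeff_mk, PowerSeries.coeff_mul, borelProdCoeff]
  rw [Finset.sum_mul, Finset.mul_sum]
  refine Finset.sum_congr rfl fun p hp => ?_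
  rw [← Finset.HasAntidiagonal.mem_antidiagonal.mp hp, triangle_add]
  simp only [qEuler, PowerSeries.coeff_mk, inv_pow, pow_add, mul_inv]
  have h1 := pow_ne_zero (p.1 * (p.1 - 1) / 2) hq'
  have h2 := pow_ne_zero (p.2 * (p.2 - 1) / 2) hq'
  have h3 := pow_ne_zero (p.1 * p.2) hq'
  rw [neg_pow a⁻¹, neg_pow b⁻¹, inv_pow, inv_pow]
  field_simp

theorem isConvergent_of_bound {f : ℂ⟦X⟧} {K M : ℝ} (hM : 0 ≤ M)
    (h : ∀ n, ‖PowerSeries.coeff n f‖ ≤ K * M ^ n) : IsConvergent f := by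
  -- `M + 1` in place of `M` keeps the radius meaningful when `M = 0`.
  refine ⟨(2 * (M + 1))⁻¹, by positivity, ?_⟩
  refine Summable.of_nonneg_of_le (fun n => by positivity) (fun n => ?_)
    (summable_geometric_two.mul_left K)
  have hK : 0 ≤ K := by simpa using (norm_nonneg _).trans (h 0)
  calc ‖PowerSeries.coeff n f‖ * (2 * (M + 1))⁻¹ ^ n
      ≤ K * M ^ n * (2 * (M + 1))⁻¹ ^ n := by gcongr; exact h n
    _ = K * (M * (2 * (M + 1))⁻¹) ^ n := by rw [mul_pow]; ring
    _ ≤ K * (1 / 2) ^ n := by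
        gcongr
        rw [← div_eq_mul_inv, div_le_div_iff₀ (by positivity) (by norm_num)]
        linarith

theorem isConvergent_formalBorel_qEuler {q : ℝ} (hq : q ≠ 0) (a : ℂ) :
    IsConvergent (formalBorel q (qEuler q a)) :=
  isConvergent_of_bound (K := ‖a⁻¹‖) (norm_nonneg (-a⁻¹)) fun n => by
    rw [coeff_formalBorel_qEuler hq, norm_mul, norm_pow]

theorem isConvergent_formalBorel_qEuler_mul {q : ℝ} (hq : 1 < q) (a b : ℂ) :
    IsConvergent (formalBorel q (qEuler q a * qEuler q b)) := by
  refine isConvergent_of_bound (K := ‖(a * b)⁻¹‖)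
    (M := 2 * max ‖-a⁻¹‖ ‖-b⁻¹‖) (by positivity) fun n => ?_
  rw [coeff_formalBorel_qEuler_mul (by positivity), norm_mul]
  gcongr
  refine norm_borelProdCoeff_le (le_max_left _ _) (le_max_right _ _) ?_ n
  rw [norm_inv, Complex.norm_real, Real.norm_of_nonneg (by linarith)]
  exact inv_le_one_of_one_le₀ hq.le

theorem germOf_formalBorel_qEuler {q : ℝ} (hq : q ≠ 0) {a : ℂ} (ha : a ≠ 0) {w : ℂ}
    (hw : w ∈ logDisc ‖a‖) :
    germOf (formalBorel q (qEuler q a)) w = a⁻¹ * eulerPole a w := by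
  have hlt : ‖-a⁻¹ * Complex.exp w‖ < 1 := by
    rw [norm_mul, norm_neg, norm_inv, Complex.norm_exp, inv_mul_lt_one₀ (norm_pos_iff.mpr ha)]
    exact hw
  simp only [germOf, LogSurface.proj, coeff_formalBorel_qEuler hq, mul_assoc, ← mul_pow]
  rw [tsum_mul_left, tsum_geometric_of_norm_lt_one hlt, eulerPole]
  congr 2
  ring

/-! ### Gaussian integrals -/

/-- The Gaussian kernel of variance `σ`, without the normalizing factor. -/
noncomputable def gaussKer (σ : ℝ) (z : ℂ) : ℂ := Complex.exp (-z ^ 2 / (2 * (σ : ℂ)))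

theorem continuous_gaussKer (σ : ℝ) : Continuous (gaussKer σ) := by
  unfold gaussKer
  fun_prop

theorem differentiable_gaussKer (σ : ℝ) : Differentiable ℂ (gaussKer σ) := by
  unfold gaussKer
  fun_prop

theorem norm_gaussKer (σ : ℝ) (z : ℂ) :
    ‖gaussKer σ z‖ = Real.exp (-(z.re ^ 2 - z.im ^ 2) / (2 * σ)) := by
  rw [gaussKer, Complex.norm_exp]
  have : -z ^ 2 / (2 * (σ : ℂ)) = ((1 / (2 * σ) : ℝ) : ℂ) * (-z ^ 2) := by
    push_cast
    ring
  rw [this, Complex.re_ofReal_mul]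
  congr 1
  simp [pow_two]
  ring

theorem integrable_exp_neg_sub_sq {σ : ℝ} (hσ : 0 < σ) (c : ℝ) :
    MeasureTheory.Integrable fun t : ℝ => Real.exp (-(t - c) ^ 2 / σ) := by
  refine ((integrable_exp_neg_mul_sq (inv_pos.mpr hσ)).comp_sub_right c).congr
    (Filter.Eventually.of_forall fun t => ?_)
  simp only
  congr 1
  ring

/-- A majorant independent of `y` near `z`: moving the centre by at most `1` costs a constant and
half of the quadratic decay, whence `4 * σ`. -/
theorem norm_gaussKer_le {σ : ℝ} (hσ : 0 < σ) {y z : ℂ} (h : dist y z < 1) (t : ℝ) :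
    ‖gaussKer σ (y - t)‖
      ≤ Real.exp ((1 + (|z.im| + 1) ^ 2) / (2 * σ)) * Real.exp (-(t - z.re) ^ 2 / (4 * σ)) := by
  rw [norm_gaussKer, ← Real.exp_add, Real.exp_le_exp]
  have h1 : |(y - z).re| ≤ 1 := (Complex.abs_re_le_norm _).trans (by
    rw [← dist_eq_norm]
    exact h.le)
  have h2 : |(y - z).im| ≤ 1 := (Complex.abs_im_le_norm _).trans (by
    rw [← dist_eq_norm]
    exact h.le)
  rw [Complex.sub_re] at h1
  rw [Complex.sub_im] at h2
  have h3 : |y.im| ≤ |z.im| + 1 := by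
    have := abs_sub_abs_le_abs_sub y.im z.im
    linarith
  have h4 : y.im ^ 2 ≤ (|z.im| + 1) ^ 2 := by
    rw [← sq_abs]
    gcongr
  have h5 : (y.re - z.re) ^ 2 ≤ 1 := by
    rw [← sq_abs]
    exact pow_le_one₀ (abs_nonneg _) h1
  have h6 : (t - z.re) ^ 2 / 2 - 1 ≤ (y.re - t) ^ 2 := by
    nlinarith [sq_nonneg ((y.re - t) + (y.re - t) - (z.re - t))]
  rw [Complex.sub_re, Complex.sub_im, Complex.ofReal_re, Complex.ofReal_im, sub_zero]
  have : (1 + (|z.im| + 1) ^ 2) / (2 * σ) + -(t - z.re) ^ 2 / (4 * σ)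
      = (1 + (|z.im| + 1) ^ 2 - (t - z.re) ^ 2 / 2) / (2 * σ) := by
    field_simp
    ring
  rw [this]
  gcongr
  linarith

theorem integrable_gaussKer_mul {σ : ℝ} (hσ : 0 < σ) (y : ℂ) {f : ℝ → ℂ} (hf : Continuous f)
    {C : ℝ} (hC : ∀ t, ‖f t‖ ≤ C) :
    MeasureTheory.Integrable fun t : ℝ => gaussKer σ (y - t) * f t := by
  refine MeasureTheory.Integrable.mono'
    (((integrable_exp_neg_sub_sq (by positivity : 0 < 4 * σ) y.re).const_mul
      (Real.exp ((1 + (|y.im| + 1) ^ 2) / (2 * σ)))).mul_const C) ?_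
    (Filter.Eventually.of_forall fun t => ?_)
  · have := continuous_gaussKer σ
    exact Continuous.aestronglyMeasurable (by fun_prop)
  · rw [norm_mul]
    exact mul_le_mul (norm_gaussKer_le hσ (by simp) t) (hC t) (norm_nonneg _) (by positivity)

theorem differentiable_integral_gaussKer_mul {σ : ℝ} (hσ : 0 < σ) {f : ℝ → ℂ}
    (hf : Continuous f) {C : ℝ} (hC : ∀ t, ‖f t‖ ≤ C) :
    Differentiable ℂ fun y : ℂ => ∫ t : ℝ, gaussKer σ (y - t) * f t := by
  rw [← differentiableOn_univ]
  refine differentiableOn_integral_of_locally_dominated isOpen_univ (fun t => ?_)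
    (fun y _ => (integrable_gaussKer_mul hσ y hf hC).aestronglyMeasurable) fun z _ => ?_
  · have := differentiable_gaussKer σ
    exact Differentiable.differentiableOn (by fun_prop)
  · refine ⟨_, ((integrable_exp_neg_sub_sq (by positivity : 0 < 4 * σ) z.re).const_mul
      (Real.exp ((1 + (|z.im| + 1) ^ 2) / (2 * σ)))).mul_const C, ?_⟩
    filter_upwards [Metric.ball_mem_nhds z one_pos] with y hy t
    rw [norm_mul]
    exact mul_le_mul (norm_gaussKer_le hσ hy t) (hC t) (norm_nonneg _) (by positivity)

/-- The product of two Gaussian convolutions, in the coordinates `u = (s + t) / 2` and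
`v = (s - t) / 2`. -/
theorem integral_gaussKer_mul_integral_gaussKer {σ : ℝ} (hσ : 0 < σ) (X : ℂ) {f g : ℝ → ℂ}
    (hf : Continuous f) (hg : Continuous g) {C D : ℝ} (hC : ∀ t, ‖f t‖ ≤ C)
    (hD : ∀ t, ‖g t‖ ≤ D) :
    ∫ u : ℝ, gaussKer σ (X - u) * ∫ v : ℝ, gaussKer σ v * (f (u + v) * g (u - v))
      = 1 / 2 * ((∫ s : ℝ, gaussKer (2 * σ) (X - s) * f s)
        * ∫ t : ℝ, gaussKer (2 * σ) (X - t) * g t) := by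
  have hker := continuous_gaussKer σ
  have hσ' : (σ : ℂ) ≠ 0 := by exact_mod_cast hσ.ne'
  have hC0 : 0 ≤ C := (norm_nonneg _).trans (hC 0)
  have hD0 : 0 ≤ D := (norm_nonneg _).trans (hD 0)
  -- Substitute `s = u + v`, so that `u - v = 2u - s` plays the role of `t`.
  have hshift : ∀ u : ℝ, ∫ v : ℝ, gaussKer σ v * (f (u + v) * g (u - v))
      = ∫ s : ℝ, gaussKer σ ((s - u : ℝ) : ℂ) * (f s * g (2 * u - s)) := fun u => by
    rw [← MeasureTheory.integral_sub_right_eq_self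
      (fun v : ℝ => gaussKer σ v * (f (u + v) * g (u - v))) u]
    refine MeasureTheory.integral_congr_ae (Filter.Eventually.of_forall fun s => ?_)
    simp only
    rw [add_sub_cancel]
    congr 3
    ring
  have hint : MeasureTheory.Integrable (Function.uncurry fun u s : ℝ =>
      gaussKer σ (X - u) * (gaussKer σ ((s - u : ℝ) : ℂ) * (f s * g (2 * u - s))))
      (MeasureTheory.volume.prod MeasureTheory.volume) := by
    -- Joint decay in `(u, s)` comes from `(u - c)² + (s - u)² ≥ ((u - c)² + (s - c)²) / 4` with `c
    -- = re X`, hence `8 * σ`.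
    have hdom := ((integrable_exp_neg_sub_sq (by positivity : 0 < 8 * σ) X.re).mul_prod
      (integrable_exp_neg_sub_sq (by positivity : 0 < 8 * σ) X.re)).const_mul
      (Real.exp (X.im ^ 2 / (2 * σ)) * (C * D))
    refine hdom.mono' ?_ (Filter.Eventually.of_forall fun p => ?_)
    · refine Continuous.aestronglyMeasurable ?_
      unfold Function.uncurry
      fun_prop
    · obtain ⟨u, s⟩ := p
      simp only [Function.uncurry_apply_pair, norm_mul, norm_gaussKer]
      have hfg : ‖f s‖ * ‖g (2 * u - s)‖ ≤ C * D := by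
        have := hC s
        have := hD (2 * u - s)
        gcongr
      have hexp : Real.exp (-((X - u).re ^ 2 - (X - u).im ^ 2) / (2 * σ))
          * Real.exp (-((((s - u : ℝ) : ℂ)).re ^ 2 - (((s - u : ℝ) : ℂ)).im ^ 2) / (2 * σ))
          ≤ Real.exp (X.im ^ 2 / (2 * σ)) * (Real.exp (-(u - X.re) ^ 2 / (8 * σ))
            * Real.exp (-(s - X.re) ^ 2 / (8 * σ))) := by
        rw [← Real.exp_add, ← Real.exp_add, ← Real.exp_add, Real.exp_le_exp]
        simp only [Complex.sub_re, Complex.sub_im, Complex.ofReal_re, Complex.ofReal_im, sub_zero]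
        have e1 : -((X.re - u) ^ 2 - X.im ^ 2) / (2 * σ) + -((s - u) ^ 2 - 0 ^ 2) / (2 * σ)
            = (X.im ^ 2 - (X.re - u) ^ 2 - (s - u) ^ 2) / (2 * σ) := by ring
        have e2 : X.im ^ 2 / (2 * σ) + (-(u - X.re) ^ 2 / (8 * σ) + -(s - X.re) ^ 2 / (8 * σ))
            = (X.im ^ 2 - (u - X.re) ^ 2 / 4 - (s - X.re) ^ 2 / 4) / (2 * σ) := by
          field_simp
          ring
        rw [e1, e2]
        refine div_le_div_of_nonneg_right ?_ (by positivity)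
        nlinarith [sq_nonneg (3 * (s - X.re) - 4 * (u - X.re)), sq_nonneg (u - X.re)]
      calc _ = (Real.exp (-((X - u).re ^ 2 - (X - u).im ^ 2) / (2 * σ))
          * Real.exp (-((((s - u : ℝ) : ℂ)).re ^ 2 - (((s - u : ℝ) : ℂ)).im ^ 2) / (2 * σ)))
            * (‖f s‖ * ‖g (2 * u - s)‖) := by ring
        _ ≤ (Real.exp (X.im ^ 2 / (2 * σ)) * (Real.exp (-(u - X.re) ^ 2 / (8 * σ))
            * Real.exp (-(s - X.re) ^ 2 / (8 * σ)))) * (C * D) := by gcongr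
        _ = _ := by ring
  calc ∫ u : ℝ, gaussKer σ (X - u) * ∫ v : ℝ, gaussKer σ v * (f (u + v) * g (u - v))
      = ∫ u : ℝ, ∫ s : ℝ,
        gaussKer σ (X - u) * (gaussKer σ ((s - u : ℝ) : ℂ) * (f s * g (2 * u - s))) := by
        simp_rw [hshift, MeasureTheory.integral_const_mul]
    _ = ∫ s : ℝ, ∫ u : ℝ,
        gaussKer σ (X - u) * (gaussKer σ ((s - u : ℝ) : ℂ) * (f s * g (2 * u - s))) :=
        MeasureTheory.integral_integral_swap hint
    _ = ∫ s : ℝ, (gaussKer (2 * σ) (X - s) * f s)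
        * (1 / 2 * ∫ t : ℝ, gaussKer (2 * σ) (X - t) * g t) := by
        refine MeasureTheory.integral_congr_ae (Filter.Eventually.of_forall fun s => ?_)
        simp only
        -- For fixed `s`, the substitution `t = 2u - s` produces the Jacobian `1 / 2`.
        have h1 := MeasureTheory.Measure.integral_comp_mul_left
          (fun t : ℝ => gaussKer (2 * σ) (X - s) * f s
            * (gaussKer (2 * σ) (X - ((t - s : ℝ) : ℂ)) * g (t - s))) 2
        rw [MeasureTheory.integral_sub_right_eq_self (fun t : ℝ => gaussKer (2 * σ) (X - s) * f s
            * (gaussKer (2 * σ) (X - t) * g t)) s] at h1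
        rw [mul_left_comm, ← mul_assoc]
        have h2 : ∀ z : ℂ, |(2 : ℝ)⁻¹| • z = 1 / 2 * z := fun z => by
          rw [abs_of_pos (by norm_num), Complex.real_smul]
          norm_num
        rw [h2] at h1
        rw [mul_assoc, ← MeasureTheory.integral_const_mul, ← h1]
        refine MeasureTheory.integral_congr_ae (Filter.Eventually.of_forall fun u => ?_)
        simp only
        -- Parallelogram law: with `α = X - u` and `β = s - u`, `α² + β² = ((α - β)² + (α + β)²) /
        -- 2`.
        have h3 : gaussKer σ (X - u) * gaussKer σ ((s - u : ℝ) : ℂ)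
            = gaussKer (2 * σ) (X - s) * gaussKer (2 * σ) (X - ((2 * u - s : ℝ) : ℂ)) := by
          simp only [gaussKer]
          rw [← Complex.exp_add, ← Complex.exp_add]
          congr 1
          push_cast
          field_simp
          ring
        linear_combination f s * g (2 * u - s) * h3
    _ = _ := by
        rw [MeasureTheory.integral_mul_const]
        ring

/-! ### The theta-like continuation of the Borel transform -/

/-- The function `a / (a + ξ) + b / (b + ξ) - 1` in the logarithmic coordinate. -/
noncomputable def poleSum (a b w : ℂ) : ℂ := eulerPole a w + eulerPole b w - 1

/-- The `n`-th term of the expansion `borelSum`. -/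
noncomputable def borelTerm (σ : ℝ) (a b : ℂ) (n : ℕ) (w : ℂ) : ℂ :=
  Complex.exp (2 * n * w - (n : ℂ) ^ 2 * (2 * σ)) * ((a * b) ^ n)⁻¹ * poleSum a b (w - n * (2 * σ))

/-- The continuation of the `q`-Borel transform of the product of two `q`-Euler series, up to a
constant factor, where `2 * σ = log q`. -/
noncomputable def borelSum (σ : ℝ) (a b w : ℂ) : ℂ := ∑' n : ℕ, borelTerm σ a b n w

theorem shift_mem_logSector {d ε : ℝ} {w : ℂ} (hw : w ∈ logSector d ε) (n : ℕ) (σ : ℝ) :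
    w - n * (2 * σ) ∈ logSector d ε := by
  simpa using sub_ofReal_mem_logSector hw (n * (2 * σ))

theorem norm_borelTerm {σ : ℝ} {a b : ℂ} (hab : a * b ≠ 0) (n : ℕ) (w : ℂ) :
    ‖borelTerm σ a b n w‖
      = Real.exp (2 * n * (w.re - Real.log ‖a * b‖ / 2) - n ^ 2 * (2 * σ))
        * ‖poleSum a b (w - n * (2 * σ))‖ := by
  have h1 : (‖a * b‖ ^ n)⁻¹ = Real.exp (-(n * Real.log ‖a * b‖)) := by
    rw [Real.exp_neg, Real.exp_nat_mul, Real.exp_log (norm_pos_iff.mpr hab)]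
  have h2 : 2 * (n : ℂ) * w - (n : ℂ) ^ 2 * (2 * σ)
      = ((2 * n : ℝ) : ℂ) * w - (((n : ℝ) ^ 2 * (2 * σ) : ℝ) : ℂ) := by
    push_cast
    ring
  rw [borelTerm, norm_mul, norm_mul, norm_inv, norm_pow, h1, Complex.norm_exp, ← Real.exp_add, h2,
    Complex.sub_re, Complex.re_ofReal_mul, Complex.ofReal_re]
  congr 2
  ring

/-- Completing the square, `2nu - 2σn² ≤ (u + 1)² / (2σ) - 2n`: the extra `1` buys the summable
factor `e^(-2n)`. The bound depends on `s` only, so it is uniform on left half planes of the sector.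
-/
theorem norm_borelTerm_le {σ : ℝ} (hσ : 0 < σ) {a b : ℂ} (hab : a * b ≠ 0) {d ε C : ℝ}
    (hC : ∀ w ∈ logSector d ε, ‖poleSum a b w‖ ≤ C) {w : ℂ} (hw : w ∈ logSector d ε) {s : ℝ}
    (hs : w.re ≤ s) (n : ℕ) :
    ‖borelTerm σ a b n w‖
      ≤ C * Real.exp ((s - Real.log ‖a * b‖ / 2 + 1) ^ 2 / (2 * σ)) * Real.exp (-2) ^ n := by
  rw [norm_borelTerm hab, ← Real.exp_nat_mul, mul_assoc C, ← Real.exp_add, mul_comm C]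
  refine mul_le_mul (Real.exp_le_exp.mpr ?_) (hC _ (shift_mem_logSector hw n σ)) (norm_nonneg _)
    (Real.exp_pos _).le
  set u := s - Real.log ‖a * b‖ / 2 with hu
  have h1 : 2 * n * (w.re - Real.log ‖a * b‖ / 2) ≤ 2 * n * u := by
    rw [hu]
    gcongr
  have h2 : 0 ≤ (n * (2 * σ) - (u + 1)) ^ 2 / (2 * σ) := by positivity
  have h3 : (n * (2 * σ) - (u + 1)) ^ 2 / (2 * σ)
      = (u + 1) ^ 2 / (2 * σ) - 2 * n * (u + 1) + n ^ 2 * (2 * σ) := by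
    field_simp
    ring
  linarith

theorem exp_neg_two_lt_one : Real.exp (-2) < 1 := by
  rw [Real.exp_lt_one_iff]
  norm_num

theorem summable_exp_neg_two_pow : Summable fun n : ℕ => Real.exp (-2) ^ n :=
  summable_geometric_of_lt_one (Real.exp_pos _).le exp_neg_two_lt_one

theorem summable_borelTerm {σ : ℝ} (hσ : 0 < σ) {a b : ℂ} (hab : a * b ≠ 0) {d ε C : ℝ}
    (hC : ∀ w ∈ logSector d ε, ‖poleSum a b w‖ ≤ C) {w : ℂ} (hw : w ∈ logSector d ε) :
    Summable fun n => borelTerm σ a b n w :=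
  Summable.of_norm_bounded (summable_exp_neg_two_pow.mul_left _)
    (norm_borelTerm_le hσ hab hC hw le_rfl)

theorem norm_borelSum_le {σ : ℝ} (hσ : 0 < σ) {a b : ℂ} (hab : a * b ≠ 0) {d ε C : ℝ}
    (hC : ∀ w ∈ logSector d ε, ‖poleSum a b w‖ ≤ C) {w : ℂ} (hw : w ∈ logSector d ε) {s : ℝ}
    (hs : w.re ≤ s) :
    ‖borelSum σ a b w‖ ≤ C * Real.exp ((s - Real.log ‖a * b‖ / 2 + 1) ^ 2 / (2 * σ))
      * (1 - Real.exp (-2))⁻¹ :=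
  tsum_of_norm_bounded
    ((hasSum_geometric_of_lt_one (Real.exp_pos _).le exp_neg_two_lt_one).mul_left _)
    (norm_borelTerm_le hσ hab hC hw hs)

theorem differentiableOn_borelSum {σ : ℝ} (hσ : 0 < σ) {a b : ℂ} (hab : a * b ≠ 0) {d ε C : ℝ}
    (hC : ∀ w ∈ logSector d ε, ‖poleSum a b w‖ ≤ C)
    (hd : DifferentiableOn ℂ (poleSum a b) (logSector d ε)) :
    DifferentiableOn ℂ (borelSum σ a b) (logSector d ε) := by
  intro w hw
  have hopen : IsOpen (logSector d ε ∩ {z : ℂ | z.re < w.re + 1}) :=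
    (isOpen_logSector d ε).inter (isOpen_lt Complex.continuous_re continuous_const)
  have hmem : w ∈ logSector d ε ∩ {z : ℂ | z.re < w.re + 1} := ⟨hw, lt_add_one w.re⟩
  have h : DifferentiableOn ℂ (borelSum σ a b) (logSector d ε ∩ {z : ℂ | z.re < w.re + 1}) := by
    refine Complex.differentiableOn_tsum_of_summable_norm
      (summable_exp_neg_two_pow.mul_left
        (C * Real.exp ((w.re + 1 - Real.log ‖a * b‖ / 2 + 1) ^ 2 / (2 * σ))))
      (fun n => ?_) hopen fun n z hz => norm_borelTerm_le hσ hab hC hz.1 (le_of_lt hz.2) n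
    have h1 : DifferentiableOn ℂ (fun z : ℂ => poleSum a b (z - n * (2 * σ)))
        (logSector d ε ∩ {z : ℂ | z.re < w.re + 1}) :=
      hd.comp (f := fun z : ℂ => z - n * (2 * σ)) (by fun_prop)
        fun z hz => shift_mem_logSector hz.1 n σ
    unfold borelTerm
    exact DifferentiableOn.mul (by fun_prop) h1
  exact (h.differentiableAt (hopen.mem_nhds hmem)).differentiableWithinAt

theorem const_mul_borelSum_mem_qExpGrowth {p : ℝ} (hp : 1 < p) {a b : ℂ} (hab : a * b ≠ 0)
    {d ε C : ℝ} (hε : 0 < ε) (hC : ∀ w ∈ logSector d ε, ‖poleSum a b w‖ ≤ C)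
    (hd : DifferentiableOn ℂ (poleSum a b) (logSector d ε)) (c : ℂ) :
    (fun w => c * borelSum (Real.log p) a b w) ∈ qExpGrowth p d := by
  have hσ : 0 < Real.log p := Real.log_pos hp
  set κ := Real.log ‖a * b‖ / 2 with hκ
  -- With `A = e^(1 - κ)`, `log (A |ξ|) = re w - κ + 1` is exactly the quantity squared in
  -- `norm_borelSum_le`, so the exponentials cancel.
  refine ⟨ε, hε, (differentiableOn_borelSum hσ hab hC hd).const_mul c, Real.exp (1 - κ), 1,
    max (‖c‖ * (C * Real.exp ((0 - κ + 1) ^ 2 / (2 * Real.log p)) * (1 - Real.exp (-2))⁻¹))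
      (‖c‖ * (C * (1 - Real.exp (-2))⁻¹)), Real.exp_pos _, one_pos, fun w hw hle => ?_,
    fun w hw _ => ?_⟩
  · refine le_max_of_le_left ?_
    rw [norm_mul]
    gcongr
    refine norm_borelSum_le hσ hab hC hw ?_
    rwa [LogSurface.modulus, Real.exp_le_one_iff] at hle
  · refine le_max_of_le_right ?_
    rw [norm_mul, LogSurface.modulus, ← Real.exp_add, Real.log_exp, mul_assoc]
    refine mul_le_mul_of_nonneg_left ?_ (norm_nonneg c)
    have h := norm_borelSum_le hσ hab hC hw le_rfl
    rw [← hκ] at h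
    calc ‖borelSum (Real.log p) a b w‖
          * Real.exp (-(1 - κ + w.re) ^ 2 / (2 * Real.log p))
        ≤ C * Real.exp ((w.re - κ + 1) ^ 2 / (2 * Real.log p)) * (1 - Real.exp (-2))⁻¹
          * Real.exp (-(1 - κ + w.re) ^ 2 / (2 * Real.log p)) := by gcongr
      _ = C * (1 - Real.exp (-2))⁻¹ * (Real.exp ((w.re - κ + 1) ^ 2 / (2 * Real.log p))
          * Real.exp (-(1 - κ + w.re) ^ 2 / (2 * Real.log p))) := by ring
      _ = C * (1 - Real.exp (-2))⁻¹ := by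
        rw [← Real.exp_add]
        have : (w.re - κ + 1) ^ 2 / (2 * Real.log p)
            + -(1 - κ + w.re) ^ 2 / (2 * Real.log p) = 0 := by ring
        rw [this, Real.exp_zero, mul_one]

theorem borelTerm_succ (σ : ℝ) (a b : ℂ) (n : ℕ) (w : ℂ) :
    borelTerm σ a b (n + 1) w
      = Complex.exp (2 * w - 2 * σ) * (a * b)⁻¹ * borelTerm σ a b n (w - 2 * σ) := by
  have h1 : w - ((n + 1 : ℕ) : ℂ) * (2 * σ) = w - 2 * σ - n * (2 * σ) := by
    push_cast
    ring
  have h2 : 2 * ((n + 1 : ℕ) : ℂ) * w - ((n + 1 : ℕ) : ℂ) ^ 2 * (2 * σ)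
      = (2 * w - 2 * σ) + (2 * n * (w - 2 * σ) - (n : ℂ) ^ 2 * (2 * σ)) := by
    push_cast
    ring
  rw [borelTerm, borelTerm, h1, h2, Complex.exp_add, pow_succ, mul_inv]
  ring

/-- This is the `q`-difference equation of the power series, now valid on the whole sector; it
serves to identify the two near `0`. -/
theorem borelSum_eq {σ : ℝ} (hσ : 0 < σ) {a b : ℂ} (hab : a * b ≠ 0) {d ε C : ℝ}
    (hC : ∀ w ∈ logSector d ε, ‖poleSum a b w‖ ≤ C) {w : ℂ} (hw : w ∈ logSector d ε) :
    borelSum σ a b w = poleSum a b w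
      + Complex.exp (2 * w - 2 * σ) * (a * b)⁻¹ * borelSum σ a b (w - 2 * σ) := by
  rw [borelSum, (summable_borelTerm hσ hab hC hw).tsum_eq_zero_add, borelSum, ← tsum_mul_left]
  simp only [borelTerm_succ]
  simp [borelTerm]

/-- Near `0` the function `borelSum` is given by its power series. -/
theorem borelSum_eq_tsum {σ : ℝ} (hσ : 0 < σ) {a b : ℂ} (ha : a ≠ 0) (hb : b ≠ 0) {d ε C : ℝ}
    (hC : ∀ w ∈ logSector d ε, ‖poleSum a b w‖ ≤ C) :
    ∃ s : ℝ, ∀ w ∈ logSector d ε, w.re ≤ s → borelSum σ a b w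
      = ∑' n, borelProdCoeff (-a⁻¹) (-b⁻¹) (Complex.exp (2 * σ))⁻¹ n * Complex.exp w ^ n := by
  have hab : a * b ≠ 0 := mul_ne_zero ha hb
  set Q : ℂ := (Complex.exp (2 * σ))⁻¹ with hQ
  set M : ℝ := max ‖-a⁻¹‖ ‖-b⁻¹‖ with hM
  have hMpos : 0 < M := lt_max_of_lt_left (norm_pos_iff.mpr (neg_ne_zero.mpr (inv_ne_zero ha)))
  have hA : ‖-a⁻¹‖ ≤ M := le_max_left _ _
  have hB : ‖-b⁻¹‖ ≤ M := le_max_right _ _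
  have hQexp : Q = Complex.exp (-(2 * σ)) := by rw [hQ, Complex.exp_neg]
  have hQ1 : ‖Q‖ ≤ 1 := by
    rw [hQexp, Complex.norm_exp, Real.exp_le_one_iff]
    simpa using hσ.le
  set g : ℂ → ℂ := fun w => ∑' n, borelProdCoeff (-a⁻¹) (-b⁻¹) Q n * Complex.exp w ^ n with hg
  have hMz : ∀ w : ℂ, w.re ≤ Real.log (1 / (4 * M)) → 2 * M * ‖Complex.exp w‖ ≤ 1 / 2 := by
    intro w hw
    rw [Complex.norm_exp]
    have : Real.exp w.re ≤ 1 / (4 * M) := by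
      rw [← Real.exp_log (by positivity : 0 < 1 / (4 * M))]
      exact Real.exp_le_exp.mpr hw
    calc 2 * M * Real.exp w.re ≤ 2 * M * (1 / (4 * M)) := by gcongr
      _ = 1 / 2 := by
        field_simp
        norm_num
  have hgeq : ∀ w : ℂ, w.re ≤ Real.log (1 / (4 * M)) →
      g w = poleSum a b w + Complex.exp (2 * w - 2 * σ) * (a * b)⁻¹ * g (w - 2 * σ) := by
    intro w hw
    have h1 : Complex.exp (w - 2 * σ) = Q * Complex.exp w := by
      rw [hQexp, ← Complex.exp_add]
      congr 1
      ring
    have h2 : Complex.exp (2 * w - 2 * σ) = Q * Complex.exp w ^ 2 := by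
      rw [hQexp, ← Complex.exp_nat_mul, ← Complex.exp_add]
      congr 1
      push_cast
      ring
    simp only [hg]
    rw [tsum_borelProdCoeff_eq hA hB hQ1 (hMz w hw), h1, h2, poleSum, eulerPole, eulerPole]
    have e1 : 1 - -a⁻¹ * Complex.exp w = 1 + Complex.exp w / a := by ring
    have e2 : 1 - -b⁻¹ * Complex.exp w = 1 + Complex.exp w / b := by ring
    rw [e1, e2, mul_inv]
    ring
  have hgle : ∀ w : ℂ, w.re ≤ Real.log (1 / (4 * M)) → ‖g w‖ ≤ 2 := fun w hw =>
    norm_tsum_borelProdCoeff_le hA hB hQ1 (hMz w hw)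
  -- The first bound puts `e^w` in the disc where the power series is controlled; the second makes
  -- the multiplier of the functional equation at most `1 / 2`.
  set s := min (Real.log (1 / (4 * M))) ((Real.log (‖a * b‖ / 2)) / 2) with hs
  set K := C * Real.exp ((s - Real.log ‖a * b‖ / 2 + 1) ^ 2 / (2 * σ)) * (1 - Real.exp (-2))⁻¹ + 2
    with hK
  refine ⟨s, ?_⟩
  have hfactor : ∀ w : ℂ, w.re ≤ s → ‖Complex.exp (2 * w - 2 * σ) * (a * b)⁻¹‖ ≤ 1 / 2 := by
    intro w hw
    have hpos : 0 < ‖a * b‖ := norm_pos_iff.mpr hab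
    have hre : (2 * w - 2 * (σ : ℂ)).re = 2 * w.re - 2 * σ := by simp
    have hw2 : w.re ≤ (Real.log (‖a * b‖ / 2)) / 2 := hw.trans (min_le_right _ _)
    rw [norm_mul, norm_inv, Complex.norm_exp, hre]
    calc Real.exp (2 * w.re - 2 * σ) * ‖a * b‖⁻¹
        ≤ Real.exp (Real.log (‖a * b‖ / 2)) * ‖a * b‖⁻¹ := by
          gcongr
          linarith
      _ = 1 / 2 := by
        rw [Real.exp_log (by positivity)]
        field_simp
  have hshift : ∀ w : ℂ, (w - 2 * (σ : ℂ)).re = w.re - 2 * σ := fun w => by simp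
  -- The difference solves the homogeneous equation. Each iteration gains `1 / 2` and moves `w` left
  -- by `2σ`, where the same bound `K` applies; so the difference vanishes.
  have hiter : ∀ (n : ℕ) (w : ℂ), w ∈ logSector d ε → w.re ≤ s →
      ‖borelSum σ a b w - g w‖ ≤ K * (1 / 2) ^ n := by
    intro n
    induction n with
    | zero =>
      intro w hw hws
      rw [pow_zero, mul_one]
      exact (norm_sub_le _ _).trans (add_le_add (norm_borelSum_le hσ hab hC hw hws)
        (hgle w (hws.trans (min_le_left _ _))))
    | succ n ih =>
      intro w hw hws
      have hw' : w - 2 * (σ : ℂ) ∈ logSector d ε := by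
        simpa using sub_ofReal_mem_logSector hw (2 * σ)
      have hws' : (w - 2 * (σ : ℂ)).re ≤ s := by
        rw [hshift]
        linarith
      have h1 : borelSum σ a b w - g w = Complex.exp (2 * w - 2 * σ) * (a * b)⁻¹
          * (borelSum σ a b (w - 2 * σ) - g (w - 2 * σ)) := by
        rw [borelSum_eq hσ hab hC hw, hgeq w (hws.trans (min_le_left _ _))]
        ring
      rw [h1, norm_mul]
      calc _ ≤ 1 / 2 * (K * (1 / 2) ^ n) :=
            mul_le_mul (hfactor w hws) (ih _ hw' hws') (norm_nonneg _) (by norm_num)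
        _ = K * (1 / 2) ^ (n + 1) := by ring
  intro w hw hws
  have hlim : Filter.Tendsto (fun n : ℕ => K * (1 / 2 : ℝ) ^ n) Filter.atTop (nhds 0) := by
    simpa using (tendsto_pow_atTop_nhds_zero_of_lt_one (by norm_num : (0 : ℝ) ≤ 1 / 2)
      (by norm_num)).const_mul K
  have h0 : ‖borelSum σ a b w - g w‖ ≤ 0 :=
    ge_of_tendsto' hlim fun n => hiter n w hw hws
  exact sub_eq_zero.mp (norm_le_zero_iff.mp h0)

/-! ### The first Laplace transform near `0` -/

/-- Completing the square: `-(y-ξ)²/(2σ) + 2nξ - 2σn² = 2ny - (y - ξ + 2σn)²/(2σ)`. -/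
theorem gaussKer_mul_borelTerm_ray {σ : ℝ} (hσ : 0 < σ) (a b y : ℂ) (d : ℝ) (n : ℕ) (t : ℝ) :
    gaussKer σ (y - LogSurface.ray d t) * borelTerm σ a b n (LogSurface.ray d t)
      = (Complex.exp (2 * y) * (a * b)⁻¹) ^ n
        * (gaussKer σ (y - LogSurface.ray d (t - n * (2 * σ)))
          * poleSum a b (LogSurface.ray d (t - n * (2 * σ)))) := by
  have hσ' : (σ : ℂ) ≠ 0 := by exact_mod_cast hσ.ne'
  have h1 : LogSurface.ray d t - n * (2 * σ) = LogSurface.ray d (t - n * (2 * σ)) := by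
    simp only [LogSurface.ray]
    push_cast
    ring
  have h2 : Complex.exp (-(y - LogSurface.ray d t) ^ 2 / (2 * σ))
      * Complex.exp (2 * n * LogSurface.ray d t - (n : ℂ) ^ 2 * (2 * σ))
      = Complex.exp (2 * y) ^ n
        * Complex.exp (-(y - (LogSurface.ray d t - n * (2 * σ))) ^ 2 / (2 * σ)) := by
    rw [← Complex.exp_nat_mul, ← Complex.exp_add, ← Complex.exp_add]
    congr 1
    field_simp
    ring
  rw [borelTerm, gaussKer, gaussKer, ← h1, mul_pow (Complex.exp (2 * y)), inv_pow]
  linear_combination ((a * b) ^ n)⁻¹ * poleSum a b (LogSurface.ray d t - n * (2 * σ)) * h2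

/-- Translates have equal integrals, so integrating termwise leaves a geometric series in `r`; `‖r‖
< 1` justifies both the interchange and its sum. -/
theorem integral_gaussKer_mul_borelSum {σ : ℝ} (hσ : 0 < σ) {a b : ℂ} {d ε C : ℝ}
    (hε : 0 < ε) (hC : ∀ w ∈ logSector d ε, ‖poleSum a b w‖ ≤ C)
    (hcont : Continuous fun t : ℝ => poleSum a b (LogSurface.ray d t)) {y : ℂ}
    (hy : ‖Complex.exp (2 * y) * (a * b)⁻¹‖ < 1) :
    (1 - Complex.exp (2 * y) * (a * b)⁻¹) * ∫ t : ℝ,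
        gaussKer σ (y - LogSurface.ray d t) * borelSum σ a b (LogSurface.ray d t)
      = ∫ t : ℝ, gaussKer σ (y - LogSurface.ray d t) * poleSum a b (LogSurface.ray d t) := by
  set r := Complex.exp (2 * y) * (a * b)⁻¹ with hr
  set F : ℝ → ℂ := fun t =>
    gaussKer σ (y - LogSurface.ray d t) * poleSum a b (LogSurface.ray d t) with hF
  have hFint : MeasureTheory.Integrable F := by
    have h := integrable_gaussKer_mul hσ (y - d * Complex.I) hcont
      fun t => hC _ (ray_mem_logSector hε t)
    refine h.congr (Filter.Eventually.of_forall fun t => ?_)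
    simp only [hF, LogSurface.ray]
    congr 2
    ring
  have hterm : ∀ (n : ℕ) (t : ℝ),
      gaussKer σ (y - LogSurface.ray d t) * borelTerm σ a b n (LogSurface.ray d t)
        = r ^ n * F (t - n * (2 * σ)) := fun n t => gaussKer_mul_borelTerm_ray hσ a b y d n t
  have hnorm : ∀ n : ℕ, ∫ t, ‖r ^ n * F (t - n * (2 * σ))‖ = ‖r‖ ^ n * ∫ t, ‖F t‖ := fun n => by
    simp only [norm_mul, norm_pow]
    rw [MeasureTheory.integral_const_mul,
      MeasureTheory.integral_sub_right_eq_self (fun t => ‖F t‖)]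
  have hsum := MeasureTheory.hasSum_integral_of_summable_integral_norm
    (F := fun (n : ℕ) (t : ℝ) => r ^ n * F (t - n * (2 * σ)))
    (fun n => (hFint.comp_sub_right _).const_mul _)
    (by
      simp only [hnorm]
      exact (summable_geometric_of_lt_one (norm_nonneg _) hy).mul_right _)
  have hint : ∀ n : ℕ, ∫ t, r ^ n * F (t - n * (2 * σ)) = r ^ n * ∫ t, F t := fun n => by
    rw [MeasureTheory.integral_const_mul, MeasureTheory.integral_sub_right_eq_self F]
  simp only [hint] at hsum
  have huniq := hsum.unique ((hasSum_geometric_of_norm_lt_one hy).mul_right (∫ t, F t))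
  have hlhs : ∫ t : ℝ,
      gaussKer σ (y - LogSurface.ray d t) * borelSum σ a b (LogSurface.ray d t)
      = ∫ t, ∑' n : ℕ, r ^ n * F (t - n * (2 * σ)) := by
    refine MeasureTheory.integral_congr_ae (Filter.Eventually.of_forall fun t => ?_)
    simp only [borelSum, ← tsum_mul_left, hterm]
  rw [hlhs, huniq, ← mul_assoc, mul_inv_cancel₀, one_mul]
  intro h
  rw [sub_eq_zero] at h
  rw [← h, norm_one] at hy
  exact lt_irrefl _ hy

/-! ### The cross integral, continuing the first Laplace transform -/

/-- The Gaussian integral of `a / (a + ξ) * b / (b + ξ')` over `ξ ξ' = exp (2 * w - σ)`. -/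
noncomputable def crossIntegral (σ : ℝ) (a b w : ℂ) : ℂ :=
  ∫ v : ℝ, gaussKer σ v
    * (eulerPole a (w - ((σ / 2 : ℝ) : ℂ) + v) * eulerPole b (w - ((σ / 2 : ℝ) : ℂ) - v))

theorem continuous_eulerPole_line {a : ℂ} {d ε : ℝ}
    (hd : DifferentiableOn ℂ (eulerPole a) (logSector d ε)) {w : ℂ} (hw : w ∈ logSector d ε) :
    Continuous fun t : ℝ => eulerPole a (w + t) :=
  hd.continuousOn.comp_continuous (by fun_prop) fun t => add_ofReal_mem_logSector hw t

theorem gaussKer_neg (σ : ℝ) (z : ℂ) : gaussKer σ (-z) = gaussKer σ z := by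
  simp [gaussKer]

theorem integrable_norm_gaussKer {σ : ℝ} (hσ : 0 < σ) :
    MeasureTheory.Integrable fun t : ℝ => ‖gaussKer σ t‖ := by
  have h := integrable_gaussKer_mul hσ 0 (continuous_const (y := (1 : ℂ))) (C := 1) (by simp)
  simpa [gaussKer_neg] using h.norm

theorem integrable_gaussKer_mul_of_bound {σ : ℝ} (hσ : 0 < σ) {f : ℝ → ℂ} (hf : Continuous f)
    {C : ℝ} (hC : ∀ t, ‖f t‖ ≤ C) :
    MeasureTheory.Integrable fun t : ℝ => gaussKer σ t * f t := by
  simpa [gaussKer_neg] using integrable_gaussKer_mul hσ 0 hf hC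

theorem norm_eulerPole_mul_le {a b : ℂ} {d ε C D : ℝ}
    (hC : ∀ w ∈ logSector d ε, ‖eulerPole a w‖ ≤ C)
    (hD : ∀ w ∈ logSector d ε, ‖eulerPole b w‖ ≤ D) {σ : ℝ} {w : ℂ} (hw : w ∈ logSector d ε)
    (v : ℝ) :
    ‖eulerPole a (w - ((σ / 2 : ℝ) : ℂ) + v) * eulerPole b (w - ((σ / 2 : ℝ) : ℂ) - v)‖
      ≤ C * D := by
  have hw' := sub_ofReal_mem_logSector hw (σ / 2)
  rw [norm_mul]
  exact mul_le_mul (hC _ (add_ofReal_mem_logSector hw' v)) (hD _ (sub_ofReal_mem_logSector hw' v))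
    (norm_nonneg _) ((norm_nonneg _).trans (hC _ hw))

theorem continuous_eulerPole_mul {a b : ℂ} {d ε : ℝ}
    (hda : DifferentiableOn ℂ (eulerPole a) (logSector d ε))
    (hdb : DifferentiableOn ℂ (eulerPole b) (logSector d ε)) {σ : ℝ} {w : ℂ}
    (hw : w ∈ logSector d ε) : Continuous fun v : ℝ =>
      eulerPole a (w - ((σ / 2 : ℝ) : ℂ) + v) * eulerPole b (w - ((σ / 2 : ℝ) : ℂ) - v) := by
  have hw' := sub_ofReal_mem_logSector hw (σ / 2)
  have h2 := (continuous_eulerPole_line hdb hw').comp continuous_neg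
  simp only [Function.comp_def, Complex.ofReal_neg, ← sub_eq_add_neg] at h2
  exact (continuous_eulerPole_line hda hw').mul h2

theorem differentiableOn_crossIntegral {σ : ℝ} (hσ : 0 < σ) {a b : ℂ} {d ε C D : ℝ}
    (hC : ∀ w ∈ logSector d ε, ‖eulerPole a w‖ ≤ C)
    (hD : ∀ w ∈ logSector d ε, ‖eulerPole b w‖ ≤ D)
    (hda : DifferentiableOn ℂ (eulerPole a) (logSector d ε))
    (hdb : DifferentiableOn ℂ (eulerPole b) (logSector d ε)) :
    DifferentiableOn ℂ (crossIntegral σ a b) (logSector d ε) := by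
  refine differentiableOn_integral_of_locally_dominated (isOpen_logSector d ε) (fun v => ?_)
    (fun w hw => ?_) fun w hw => ?_
  · refine DifferentiableOn.const_mul (DifferentiableOn.mul ?_ ?_) _
    · exact hda.comp (f := fun w : ℂ => w - ((σ / 2 : ℝ) : ℂ) + v) (by fun_prop) fun w hw =>
        add_ofReal_mem_logSector (sub_ofReal_mem_logSector hw _) v
    · exact hdb.comp (f := fun w : ℂ => w - ((σ / 2 : ℝ) : ℂ) - v) (by fun_prop) fun w hw =>
        sub_ofReal_mem_logSector (sub_ofReal_mem_logSector hw _) v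
  · exact (integrable_gaussKer_mul_of_bound hσ (continuous_eulerPole_mul hda hdb hw)
      (norm_eulerPole_mul_le hC hD hw)).aestronglyMeasurable
  · refine ⟨_, (integrable_norm_gaussKer hσ).mul_const (C * D), ?_⟩
    filter_upwards [(isOpen_logSector d ε).mem_nhds hw] with y hy v
    rw [norm_mul]
    exact mul_le_mul_of_nonneg_left (norm_eulerPole_mul_le hC hD hy v) (norm_nonneg _)

theorem norm_crossIntegral_le {σ : ℝ} (hσ : 0 < σ) {a b : ℂ} {d ε C D : ℝ}
    (hC : ∀ w ∈ logSector d ε, ‖eulerPole a w‖ ≤ C)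
    (hD : ∀ w ∈ logSector d ε, ‖eulerPole b w‖ ≤ D) {w : ℂ} (hw : w ∈ logSector d ε) :
    ‖crossIntegral σ a b w‖ ≤ ∫ t : ℝ, ‖gaussKer σ t‖ * (C * D) := by
  refine MeasureTheory.norm_integral_le_of_norm_le
    ((integrable_norm_gaussKer hσ).mul_const (C * D)) (Filter.Eventually.of_forall fun v => ?_)
  rw [norm_mul]
  exact mul_le_mul_of_nonneg_left (norm_eulerPole_mul_le hC hD hw v) (norm_nonneg _)

/-- The partial fraction identity behind the theorem. The prefactor does not depend on `v`, so it
can leave the integral over `v`. -/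
theorem one_sub_mul_eulerPole_mul {a b y v : ℂ} (ha : 1 + Complex.exp (y + v) / a ≠ 0)
    (hb : 1 + Complex.exp (y - v) / b ≠ 0) :
    (1 - Complex.exp (2 * y) * (a * b)⁻¹) * (eulerPole a (y + v) * eulerPole b (y - v))
      = eulerPole a (y + v) + eulerPole b (y - v) - 1 := by
  have h : Complex.exp (2 * y) * (a * b)⁻¹
      = Complex.exp (y + v) / a * (Complex.exp (y - v) / b) := by
    have : Complex.exp (2 * y) = Complex.exp (y + v) * Complex.exp (y - v) := by
      rw [← Complex.exp_add]
      congr 1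
      ring
    rw [this, mul_inv]
    ring
  rw [h, eulerPole, eulerPole]
  field_simp
  ring

/-- For a point on the ray, `y + v` runs over the ray itself; evenness of the Gaussian replaces `y -
v` by `y + v` in the second pole. -/
theorem one_sub_mul_crossIntegral_ray {σ : ℝ} (hσ : 0 < σ) {a b : ℂ} {d ε C D : ℝ} (hε : 0 < ε)
    (ha : ∀ w ∈ logSector d ε, 1 + Complex.exp w / a ≠ 0)
    (hb : ∀ w ∈ logSector d ε, 1 + Complex.exp w / b ≠ 0)
    (hC : ∀ w ∈ logSector d ε, ‖eulerPole a w‖ ≤ C)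
    (hD : ∀ w ∈ logSector d ε, ‖eulerPole b w‖ ≤ D) (s : ℝ) :
    (1 - Complex.exp (2 * (LogSurface.ray d s - ((σ / 2 : ℝ) : ℂ))) * (a * b)⁻¹)
        * crossIntegral σ a b (LogSurface.ray d s)
      = ∫ t : ℝ, gaussKer σ (LogSurface.ray d s - ((σ / 2 : ℝ) : ℂ) - LogSurface.ray d t)
        * poleSum a b (LogSurface.ray d t) := by
  set y : ℂ := LogSurface.ray d s - ((σ / 2 : ℝ) : ℂ) with hy
  have hymem : y ∈ logSector d ε := sub_ofReal_mem_logSector (ray_mem_logSector hε s) _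
  have hda := eulerPole_differentiableOn ha
  have hdb := eulerPole_differentiableOn hb
  have hca := continuous_eulerPole_line hda hymem
  have hcb := continuous_eulerPole_line hdb hymem
  have hia := integrable_gaussKer_mul_of_bound hσ hca
    fun t => hC _ (add_ofReal_mem_logSector hymem t)
  have hib := integrable_gaussKer_mul_of_bound hσ hcb
    fun t => hD _ (add_ofReal_mem_logSector hymem t)
  have hi1 := integrable_gaussKer_mul_of_bound hσ (continuous_const (y := (1 : ℂ))) (C := 1)
    (by simp)
  have hneg : ∀ v : ℝ, gaussKer σ v * eulerPole b (y - v)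
      = (fun u : ℝ => gaussKer σ u * eulerPole b (y + u)) (-v) := fun v => by
    simp only [Complex.ofReal_neg, gaussKer_neg, sub_eq_add_neg]
  have hib' : MeasureTheory.Integrable fun v : ℝ => gaussKer σ v * eulerPole b (y - v) := by
    simp only [hneg]
    exact hib.comp_neg
  calc (1 - Complex.exp (2 * y) * (a * b)⁻¹) * crossIntegral σ a b (LogSurface.ray d s)
      = ∫ v : ℝ, (gaussKer σ v * eulerPole a (y + v) + gaussKer σ v * eulerPole b (y - v)
        - gaussKer σ v * 1) := by
        rw [crossIntegral, ← MeasureTheory.integral_const_mul]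
        refine MeasureTheory.integral_congr_ae (Filter.Eventually.of_forall fun v => ?_)
        simp only
        have h := one_sub_mul_eulerPole_mul (ha _ (add_ofReal_mem_logSector hymem v))
          (hb _ (sub_ofReal_mem_logSector hymem v))
        linear_combination gaussKer σ v * h
    _ = ∫ v : ℝ, (gaussKer σ v * eulerPole a (y + v) + gaussKer σ v * eulerPole b (y + v)
        - gaussKer σ v * 1) := by
        have hsplit : ∀ h : ℝ → ℂ, MeasureTheory.Integrable h →
            ∫ v : ℝ, (gaussKer σ v * eulerPole a (y + v) + h v - gaussKer σ v * 1)
              = (∫ v : ℝ, gaussKer σ v * eulerPole a (y + v)) + (∫ v, h v)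
                - ∫ v : ℝ, gaussKer σ v * 1 := fun h hh => by
          rw [MeasureTheory.integral_sub
            (f := fun v : ℝ => gaussKer σ v * eulerPole a (y + v) + h v) (hia.add hh) hi1,
            MeasureTheory.integral_add hia hh]
        rw [hsplit _ hib', hsplit _ hib]
        simp only [hneg]
        rw [MeasureTheory.integral_neg_eq_self
          (fun u : ℝ => gaussKer σ u * eulerPole b (y + u)) MeasureTheory.volume]
    _ = ∫ t : ℝ, gaussKer σ (y - LogSurface.ray d t) * poleSum a b (LogSurface.ray d t) := by
        rw [← MeasureTheory.integral_add_right_eq_self (fun t : ℝ =>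
          gaussKer σ (y - LogSurface.ray d t) * poleSum a b (LogSurface.ray d t)) (s - σ / 2)]
        refine MeasureTheory.integral_congr_ae (Filter.Eventually.of_forall fun v => ?_)
        simp only
        have h1 : LogSurface.ray d (v + (s - σ / 2)) = y + v := by
          simp only [hy, LogSurface.ray]
          push_cast
          ring
        rw [h1, sub_add_cancel_left, gaussKer_neg, poleSum]
        ring

theorem continuous_poleSum_ray {a b : ℂ} {d ε : ℝ} (hε : 0 < ε)
    (hd : DifferentiableOn ℂ (poleSum a b) (logSector d ε)) :
    Continuous fun t : ℝ => poleSum a b (LogSurface.ray d t) :=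
  hd.continuousOn.comp_continuous (by unfold LogSurface.ray; fun_prop)
    fun t => ray_mem_logSector hε t

/-- Both sides are holomorphic on the sector, the right one even entire, and agree on the ray; the
identity theorem avoids any contour shift. -/
theorem one_sub_mul_crossIntegral {σ : ℝ} (hσ : 0 < σ) {a b : ℂ} {d ε C D : ℝ} (hε : 0 < ε)
    (ha : ∀ w ∈ logSector d ε, 1 + Complex.exp w / a ≠ 0)
    (hb : ∀ w ∈ logSector d ε, 1 + Complex.exp w / b ≠ 0)
    (hC : ∀ w ∈ logSector d ε, ‖eulerPole a w‖ ≤ C)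
    (hD : ∀ w ∈ logSector d ε, ‖eulerPole b w‖ ≤ D) {K : ℝ}
    (hK : ∀ w ∈ logSector d ε, ‖poleSum a b w‖ ≤ K) {w : ℂ} (hw : w ∈ logSector d ε) :
    (1 - Complex.exp (2 * (w - ((σ / 2 : ℝ) : ℂ))) * (a * b)⁻¹) * crossIntegral σ a b w
      = ∫ t : ℝ, gaussKer σ (w - ((σ / 2 : ℝ) : ℂ) - LogSurface.ray d t)
        * poleSum a b (LogSurface.ray d t) := by
  have hda := eulerPole_differentiableOn ha
  have hdb := eulerPole_differentiableOn hb
  have hcont := continuous_poleSum_ray hε ((hda.add hdb).sub_const 1)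
  have hleft : DifferentiableOn ℂ (fun w => (1 - Complex.exp (2 * (w - ((σ / 2 : ℝ) : ℂ)))
      * (a * b)⁻¹) * crossIntegral σ a b w) (logSector d ε) :=
    DifferentiableOn.mul (by fun_prop) (differentiableOn_crossIntegral hσ hC hD hda hdb)
  have hright : Differentiable ℂ (fun w => ∫ t : ℝ,
      gaussKer σ (w - ((σ / 2 : ℝ) : ℂ) - LogSurface.ray d t)
        * poleSum a b (LogSurface.ray d t)) := by
    have h := (differentiable_integral_gaussKer_mul hσ hcont
      fun t => hK _ (ray_mem_logSector hε t)).comp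
      (by fun_prop : Differentiable ℂ fun w : ℂ => w - ((σ / 2 : ℝ) : ℂ) - d * Complex.I)
    have hsub : ∀ (w : ℂ) (t : ℝ), w - ((σ / 2 : ℝ) : ℂ) - LogSurface.ray d t
        = w - ((σ / 2 : ℝ) : ℂ) - d * Complex.I - t := fun w t => by
      simp only [LogSurface.ray]
      ring
    simp only [hsub]
    exact h
  have hopen := isOpen_logSector d ε
  have hray : Filter.Tendsto (LogSurface.ray d) (nhdsWithin 0 {0}ᶜ)
      (nhdsWithin (LogSurface.ray d 0) {LogSurface.ray d 0}ᶜ) := by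
    have hc : Continuous (LogSurface.ray d) := by
      unfold LogSurface.ray
      fun_prop
    refine hc.continuousWithinAt.tendsto_nhdsWithin fun t ht h => ht ?_
    simpa [LogSurface.ray] using h
  exact AnalyticOnNhd.eqOn_of_preconnected_of_frequently_eq (hleft.analyticOnNhd hopen)
    (hright.differentiableOn.analyticOnNhd hopen) (convex_logSector d ε).isPreconnected
    (ray_mem_logSector hε 0)
    (hray.frequently (Filter.Frequently.of_forall fun s =>
      one_sub_mul_crossIntegral_ray hσ hε ha hb hC hD s)) hw

/-! ### Laplace transforms of continuations -/

theorem laplaceIntegrand_eq {p : ℝ} (hp : 1 < p) (d : ℝ) (φ : LogSurface → ℂ) (x : LogSurface)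
    (t : ℝ) :
    laplaceIntegrand p d φ x t
      = gaussKer (Real.log p) (x - ((Real.log p / 2 : ℝ) : ℂ) - LogSurface.ray d t)
        * φ (LogSurface.ray d t) := by
  rw [laplaceIntegrand, gaussKer, Real.log_sqrt (by linarith)]

/-- `continuation` is an arbitrary choice, but Laplace integrals see only the ray, where uniqueness
fixes its values. Any explicit continuation may thus replace it. -/
theorem IsContinuation.continuation_ray {d : ℝ} {g φ : LogSurface → ℂ}
    (h : IsContinuation d g φ) (t : ℝ) :
    continuation d g (LogSurface.ray d t) = φ (LogSurface.ray d t) := by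
  have hex : ∃ φ, IsContinuation d g φ := ⟨φ, h⟩
  have hc : IsContinuation d g (continuation d g) := by
    rw [continuation, dif_pos hex]
    exact Classical.choose_spec hex
  obtain ⟨ε, hε, heq⟩ := hc.unique h
  exact heq (ray_mem_logSector hε t)

theorem IsContinuation.laplaceIntegrand_continuation {d : ℝ} {g φ : LogSurface → ℂ}
    (h : IsContinuation d g φ) (p : ℝ) (x : LogSurface) :
    laplaceIntegrand p d (continuation d g) x = laplaceIntegrand p d φ x := by
  funext t
  rw [laplaceIntegrand, laplaceIntegrand, h.continuation_ray]

theorem IsContinuation.qLaplace_continuation {d : ℝ} {g φ : LogSurface → ℂ}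
    (h : IsContinuation d g φ) (p : ℝ) :
    qLaplace p d (continuation d g) = qLaplace p d φ := by
  funext x
  rw [qLaplace, qLaplace, h.laplaceIntegrand_continuation]

theorem mem_qExpGrowth_of_bounded {p d ε M : ℝ} (hp : 1 < p) (hε : 0 < ε) {φ : LogSurface → ℂ}
    (hφ : DifferentiableOn ℂ φ (logSector d ε)) (hM : ∀ w ∈ logSector d ε, ‖φ w‖ ≤ M) :
    φ ∈ qExpGrowth p d := by
  refine ⟨ε, hε, hφ, 1, 1, M, one_pos, one_pos, fun w hw _ => hM w hw, fun w hw _ => ?_⟩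
  refine (mul_le_of_le_one_right (norm_nonneg _) ?_).trans (hM w hw)
  rw [Real.exp_le_one_iff, neg_div]
  have := Real.log_pos hp
  exact neg_nonpos.mpr (by positivity)

theorem integrable_laplaceIntegrand_of_bounded {p d ε M : ℝ} (hp : 1 < p) (hε : 0 < ε)
    {φ : LogSurface → ℂ} (hφ : DifferentiableOn ℂ φ (logSector d ε))
    (hM : ∀ w ∈ logSector d ε, ‖φ w‖ ≤ M) (x : LogSurface) :
    MeasureTheory.Integrable (laplaceIntegrand p d φ x) := by
  have hcont : Continuous fun t : ℝ => φ (LogSurface.ray d t) :=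
    hφ.continuousOn.comp_continuous (by unfold LogSurface.ray; fun_prop)
      fun t => ray_mem_logSector hε t
  have h := integrable_gaussKer_mul (Real.log_pos hp)
    (x - ((Real.log p / 2 : ℝ) : ℂ) - d * Complex.I) hcont
    fun t => hM _ (ray_mem_logSector hε t)
  refine h.congr (Filter.Eventually.of_forall fun t => ?_)
  simp only
  rw [laplaceIntegrand_eq hp]
  congr 2
  simp only [LogSurface.ray]
  ring

/-! ### Orders of summation -/

theorem qRoot_one {q : ℝ} (hq : 0 < q) : qRoot q 1 = q := by
  simp [qRoot, Real.exp_log hq]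

theorem log_qRoot_two (q : ℝ) : Real.log (qRoot q 2) = Real.log q / 2 := by
  simp [qRoot]

theorem one_lt_qRoot_two {q : ℝ} (hq : 1 < q) : 1 < qRoot q 2 := by
  have := Real.log_pos hq
  rw [qRoot, Real.one_lt_exp_iff]
  push_cast
  positivity

theorem isOrderSeq_one : IsOrderSeq [1] := by
  simp [IsOrderSeq]

theorem isOrderSeq_one_two : IsOrderSeq [1, 2] := by
  simp [IsOrderSeq]

theorem tildeSeq_one : tildeSeq [1] = [1] := rfl

/-- As `1 / (1 - 1/2) = 2`, both Laplace transforms have base `q^(1/2)`. -/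
theorem tildeSeq_one_two : tildeSeq [1, 2] = [2, 2] := by
  norm_num [tildeSeq]

/-! ### The continuations and the product formula -/

theorem isContinuation_germOf_qEuler {q : ℝ} (hq : q ≠ 0) {a : ℂ} (ha : a ≠ 0) {d ε : ℝ}
    (hε : 0 < ε) (hd : DifferentiableOn ℂ (eulerPole a) (logSector d ε)) :
    IsContinuation d (germOf (formalBorel q (qEuler q a))) fun w => a⁻¹ * eulerPole a w :=
  ⟨ε, ‖a‖, hε, norm_pos_iff.mpr ha, hd.const_mul _, fun _ hw =>
    (germOf_formalBorel_qEuler hq ha hw.2).symm⟩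

theorem isContinuation_germOf_qEuler_mul {q : ℝ} (hq : 1 < q) {a b : ℂ} (ha : a ≠ 0) (hb : b ≠ 0)
    {d ε C : ℝ} (hε : 0 < ε) (hC : ∀ w ∈ logSector d ε, ‖poleSum a b w‖ ≤ C)
    (hd : DifferentiableOn ℂ (poleSum a b) (logSector d ε)) :
    IsContinuation d (germOf (formalBorel q (qEuler q a * qEuler q b)))
      fun w => (a * b)⁻¹ * borelSum (Real.log (qRoot q 2)) a b w := by
  have hσ : 0 < Real.log (qRoot q 2) := Real.log_pos (one_lt_qRoot_two hq)
  obtain ⟨s, hs⟩ := borelSum_eq_tsum hσ ha hb hC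
  refine ⟨ε, Real.exp s, hε, Real.exp_pos s,
    (differentiableOn_borelSum hσ (mul_ne_zero ha hb) hC hd).const_mul _, fun w hw => ?_⟩
  have hws : w.re ≤ s := (Real.exp_lt_exp.mp hw.2).le
  have hexp : Complex.exp (2 * (Real.log (qRoot q 2) : ℂ)) = q := by
    rw [log_qRoot_two]
    push_cast
    rw [mul_div_cancel₀ _ (two_ne_zero' ℂ), ← Complex.ofReal_exp, Real.exp_log (by linarith)]
  simp only [germOf, LogSurface.proj, coeff_formalBorel_qEuler_mul (by linarith : q ≠ 0)]
  rw [hs w hw.1 hws, hexp, ← tsum_mul_left]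
  simp only [mul_assoc]

/-- Multiplied by `1 - r`, both functions become the same Gaussian integral of `poleSum`. On `|x| <
√|ab|` one has `‖r‖ < 1`, so the factor can be cancelled. -/
theorem isContinuation_qLaplace_borelSum {p : ℝ} (hp : 1 < p) {a b : ℂ} (ha : a ≠ 0) (hb : b ≠ 0)
    {d ε C D K : ℝ} (hε : 0 < ε)
    (ha' : ∀ w ∈ logSector d ε, 1 + Complex.exp w / a ≠ 0)
    (hb' : ∀ w ∈ logSector d ε, 1 + Complex.exp w / b ≠ 0)
    (hC : ∀ w ∈ logSector d ε, ‖eulerPole a w‖ ≤ C)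
    (hD : ∀ w ∈ logSector d ε, ‖eulerPole b w‖ ≤ D)
    (hK : ∀ w ∈ logSector d ε, ‖poleSum a b w‖ ≤ K) :
    IsContinuation d (qLaplace p d fun w => (a * b)⁻¹ * borelSum (Real.log p) a b w)
      fun w => ((1 / Real.sqrt (2 * Real.pi * Real.log p) : ℝ) : ℂ) * (a * b)⁻¹
        * crossIntegral (Real.log p) a b w := by
  have hσ := Real.log_pos hp
  have hab : a * b ≠ 0 := mul_ne_zero ha hb
  have habpos : 0 < ‖a * b‖ := norm_pos_iff.mpr hab
  have hda := eulerPole_differentiableOn ha'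
  have hdb := eulerPole_differentiableOn hb'
  have hcont := continuous_poleSum_ray hε ((hda.add hdb).sub_const 1)
  refine ⟨ε, Real.sqrt ‖a * b‖, hε, Real.sqrt_pos.mpr habpos,
    (differentiableOn_crossIntegral hσ hC hD hda hdb).const_mul _, fun w hw => ?_⟩
  set y : ℂ := w - ((Real.log p / 2 : ℝ) : ℂ) with hy
  have hlt : ‖Complex.exp (2 * y) * (a * b)⁻¹‖ < 1 := by
    have hre : (2 * y).re = 2 * w.re - Real.log p := by
      rw [hy, Complex.mul_re, Complex.sub_re, Complex.ofReal_re]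
      simp only [Complex.re_ofNat, Complex.im_ofNat, zero_mul, sub_zero]
      ring
    have hw2 : Real.exp w.re < Real.sqrt ‖a * b‖ := hw.2
    rw [norm_mul, norm_inv, mul_inv_lt_iff₀ habpos, one_mul, Complex.norm_exp, hre]
    calc Real.exp (2 * w.re - Real.log p) ≤ Real.exp w.re ^ 2 := by
          rw [← Real.exp_nat_mul, Real.exp_le_exp]
          push_cast
          linarith
      _ < Real.sqrt ‖a * b‖ ^ 2 := by gcongr
      _ = ‖a * b‖ := Real.sq_sqrt habpos.le
  have hne : 1 - Complex.exp (2 * y) * (a * b)⁻¹ ≠ 0 := fun h => by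
    rw [← sub_eq_zero.mp h, norm_one] at hlt
    exact lt_irrefl _ hlt
  have h1 := integral_gaussKer_mul_borelSum hσ hε hK hcont hlt
  have h2 := one_sub_mul_crossIntegral hσ hε ha' hb' hC hD hK hw.1
  have h3 := mul_left_cancel₀ hne (h2.trans h1.symm)
  simp only [qLaplace, laplaceIntegrand_eq hp]
  rw [h3, mul_assoc, ← MeasureTheory.integral_const_mul]
  congr 1
  refine MeasureTheory.integral_congr_ae (Filter.Eventually.of_forall fun t => ?_)
  simp only [← hy]
  ring

theorem qLaplace_crossIntegral {p q : ℝ} (hp : 1 < p) (hq : Real.log q = 2 * Real.log p)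
    (hq1 : 1 < q) {a b : ℂ} {d ε C D : ℝ} (hε : 0 < ε)
    (hda : DifferentiableOn ℂ (eulerPole a) (logSector d ε))
    (hdb : DifferentiableOn ℂ (eulerPole b) (logSector d ε))
    (hC : ∀ w ∈ logSector d ε, ‖eulerPole a w‖ ≤ C)
    (hD : ∀ w ∈ logSector d ε, ‖eulerPole b w‖ ≤ D) (x : LogSurface) :
    qLaplace p d (fun w => ((1 / Real.sqrt (2 * Real.pi * Real.log p) : ℝ) : ℂ) * (a * b)⁻¹
        * crossIntegral (Real.log p) a b w) x
      = qLaplace q d (fun w => a⁻¹ * eulerPole a w) x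
        * qLaplace q d (fun w => b⁻¹ * eulerPole b w) x := by
  have hσ := Real.log_pos hp
  set σ := Real.log p with hσdef
  -- Since `σ = log √q`, this is the Gaussian centre of the base `q` transforms; at base `p` it
  -- arises as two shifts by `σ / 2`, one from the kernel and one from `crossIntegral`.
  set X : ℂ := x - σ - d * Complex.I with hX
  have hray : ∀ t : ℝ, LogSurface.ray d t ∈ logSector d ε := ray_mem_logSector hε
  have hrc : Continuous fun t : ℝ => LogSurface.ray d t := by
    unfold LogSurface.ray
    fun_prop
  have hf : Continuous fun t : ℝ => eulerPole a (LogSurface.ray d t) :=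
    hda.continuousOn.comp_continuous hrc hray
  have hg : Continuous fun t : ℝ => eulerPole b (LogSurface.ray d t) :=
    hdb.continuousOn.comp_continuous hrc hray
  have key := integral_gaussKer_mul_integral_gaussKer hσ X hf hg
    (fun t => hC _ (hray t)) (fun t => hD _ (hray t))
  have hleft : ∫ t : ℝ, gaussKer σ (x - ((σ / 2 : ℝ) : ℂ) - LogSurface.ray d t)
      * crossIntegral σ a b (LogSurface.ray d t)
      = ∫ u : ℝ, gaussKer σ (X - u) * ∫ v : ℝ, gaussKer σ v
        * (eulerPole a (LogSurface.ray d (u + v)) * eulerPole b (LogSurface.ray d (u - v))) := by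
    rw [← MeasureTheory.integral_add_right_eq_self (fun t : ℝ =>
      gaussKer σ (x - ((σ / 2 : ℝ) : ℂ) - LogSurface.ray d t)
      * crossIntegral σ a b (LogSurface.ray d t)) (σ / 2)]
    refine MeasureTheory.integral_congr_ae (Filter.Eventually.of_forall fun u => ?_)
    simp only [crossIntegral]
    have e1 : x - ((σ / 2 : ℝ) : ℂ) - LogSurface.ray d (u + σ / 2) = X - u := by
      simp only [hX, LogSurface.ray]
      push_cast
      ring
    have e2 : ∀ v : ℝ, LogSurface.ray d (u + σ / 2) - ((σ / 2 : ℝ) : ℂ) + v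
        = LogSurface.ray d (u + v) := fun v => by
      simp only [LogSurface.ray]
      push_cast
      ring
    have e3 : ∀ v : ℝ, LogSurface.ray d (u + σ / 2) - ((σ / 2 : ℝ) : ℂ) - v
        = LogSurface.ray d (u - v) := fun v => by
      simp only [LogSurface.ray]
      push_cast
      ring
    simp only [e1, e2, e3]
  have hright : ∀ c : ℂ, ∀ φ : ℂ → ℂ, qLaplace q d (fun w => c * φ w) x
      = ((1 / Real.sqrt (2 * Real.pi * (2 * σ)) : ℝ) : ℂ)
        * (c * ∫ s : ℝ, gaussKer (2 * σ) (X - s) * φ (LogSurface.ray d s)) := fun c φ => by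
    simp only [qLaplace, laplaceIntegrand_eq hq1, hq]
    rw [← MeasureTheory.integral_const_mul c]
    congr 1
    refine MeasureTheory.integral_congr_ae (Filter.Eventually.of_forall fun s => ?_)
    simp only
    have e1 : x - ((2 * σ / 2 : ℝ) : ℂ) - LogSurface.ray d s = X - s := by
      simp only [hX, LogSurface.ray]
      push_cast
      ring
    rw [e1]
    ring
  -- The Jacobian `1 / 2` exactly accounts for the change of variance from `σ` to `2σ` in the two
  -- normalizing factors.
  have hconst : ((1 / Real.sqrt (2 * Real.pi * σ) : ℝ) : ℂ) ^ 2 * (1 / 2)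
      = ((1 / Real.sqrt (2 * Real.pi * (2 * σ)) : ℝ) : ℂ) ^ 2 := by
    have hpi := Real.pi_pos
    have : (1 / Real.sqrt (2 * Real.pi * σ)) ^ 2 * (1 / 2)
        = (1 / Real.sqrt (2 * Real.pi * (2 * σ))) ^ 2 := by
      rw [div_pow, div_pow, Real.sq_sqrt (by positivity), Real.sq_sqrt (by positivity)]
      field_simp
    rw [← Complex.ofReal_pow, ← Complex.ofReal_pow, ← this]
    push_cast
    ring
  rw [hright, hright]
  simp only [qLaplace, laplaceIntegrand_eq hp, ← hσdef]
  have hpull : ∫ t : ℝ, gaussKer σ (x - ((σ / 2 : ℝ) : ℂ) - LogSurface.ray d t)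
      * (((1 / Real.sqrt (2 * Real.pi * σ) : ℝ) : ℂ) * (a * b)⁻¹
        * crossIntegral σ a b (LogSurface.ray d t))
      = ((1 / Real.sqrt (2 * Real.pi * σ) : ℝ) : ℂ) * (a * b)⁻¹
        * ∫ t : ℝ, gaussKer σ (x - ((σ / 2 : ℝ) : ℂ) - LogSurface.ray d t)
          * crossIntegral σ a b (LogSurface.ray d t) := by
    rw [← MeasureTheory.integral_const_mul]
    refine MeasureTheory.integral_congr_ae (Filter.Eventually.of_forall fun t => ?_)
    simp only
    ring
  rw [hpull, hleft, key, mul_inv]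
  linear_combination a⁻¹ * b⁻¹ * (∫ s : ℝ, gaussKer (2 * σ) (X - s)
    * eulerPole a (LogSurface.ray d s)) * (∫ s : ℝ, gaussKer (2 * σ) (X - s)
    * eulerPole b (LogSurface.ray d s)) * hconst

/-! ### The theorem -/

theorem theorem2 (q : ℝ) (hq : 1 < q) (a b : ℂ) (ha : a ≠ 0) (hb : b ≠ 0) (d : ℝ)
    (hda : ∀ k : ℤ, d ≠ (-a).arg + 2 * Real.pi * k)
    (hdb : ∀ k : ℤ, d ≠ (-b).arg + 2 * Real.pi * k) :
    qEuler q a ∈ qMultisummable q d [1] ∧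
    qEuler q b ∈ qMultisummable q d [1] ∧
    qEuler q a * qEuler q b ∈ qMultisummable q d [1, 2] ∧
    ∀ x : LogSurface,
      QMultisumConverges q d [1] (qEuler q a) x ∧
      QMultisumConverges q d [1] (qEuler q b) x ∧
      QMultisumConverges q d [1, 2] (qEuler q a * qEuler q b) x ∧
      qMultisum q d [1, 2] (qEuler q a * qEuler q b) x
        = qMultisum q d [1] (qEuler q a) x * qMultisum q d [1] (qEuler q b) x := by
  have hq0 : 0 < q := by linarith
  have hab : a * b ≠ 0 := mul_ne_zero ha hb
  obtain ⟨ε₁, C, hε₁, -, h₁⟩ := exists_eulerPole_bound ha hda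
  obtain ⟨ε₂, D, hε₂, -, h₂⟩ := exists_eulerPole_bound hb hdb
  set ε := min ε₁ ε₂
  have hε : 0 < ε := lt_min hε₁ hε₂
  have hsub₁ : logSector d ε ⊆ logSector d ε₁ := logSector_mono (min_le_left _ _)
  have hsub₂ : logSector d ε ⊆ logSector d ε₂ := logSector_mono (min_le_right _ _)
  have ha' : ∀ w ∈ logSector d ε, 1 + Complex.exp w / a ≠ 0 := fun w hw => (h₁ w (hsub₁ hw)).1
  have hb' : ∀ w ∈ logSector d ε, 1 + Complex.exp w / b ≠ 0 := fun w hw => (h₂ w (hsub₂ hw)).1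
  have hC : ∀ w ∈ logSector d ε, ‖eulerPole a w‖ ≤ C := fun w hw => (h₁ w (hsub₁ hw)).2
  have hD : ∀ w ∈ logSector d ε, ‖eulerPole b w‖ ≤ D := fun w hw => (h₂ w (hsub₂ hw)).2
  have hdiffa := eulerPole_differentiableOn ha'
  have hdiffb := eulerPole_differentiableOn hb'
  have hdiff : DifferentiableOn ℂ (poleSum a b) (logSector d ε) :=
    (hdiffa.add hdiffb).sub_const 1
  have hK : ∀ w ∈ logSector d ε, ‖poleSum a b w‖ ≤ C + D + 1 := fun w hw => by
    refine (norm_sub_le _ _).trans (add_le_add ((norm_add_le _ _).trans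
      (add_le_add (hC w hw) (hD w hw))) ?_)
    rw [norm_one]
  set p := qRoot q 2 with hp_def
  have hp : 1 < p := one_lt_qRoot_two hq
  have hlog : Real.log q = 2 * Real.log p := by
    rw [hp_def, log_qRoot_two]
    ring
  have hconta := isContinuation_germOf_qEuler hq0.ne' ha hε hdiffa
  have hcontb := isContinuation_germOf_qEuler hq0.ne' hb hε hdiffb
  have hcont₁ := isContinuation_germOf_qEuler_mul hq ha hb hε hK hdiff
  have hcont₂ := isContinuation_qLaplace_borelSum hp ha hb hε ha' hb' hC hD hK
  rw [← hp_def] at hcont₁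
  have hbounda : ∀ w ∈ logSector d ε, ‖a⁻¹ * eulerPole a w‖ ≤ ‖a⁻¹‖ * C := fun w hw => by
    rw [norm_mul]
    exact mul_le_mul_of_nonneg_left (hC w hw) (norm_nonneg _)
  have hboundb : ∀ w ∈ logSector d ε, ‖b⁻¹ * eulerPole b w‖ ≤ ‖b⁻¹‖ * D := fun w hw => by
    rw [norm_mul]
    exact mul_le_mul_of_nonneg_left (hD w hw) (norm_nonneg _)
  set c : ℂ := ((1 / Real.sqrt (2 * Real.pi * Real.log p) : ℝ) : ℂ) * (a * b)⁻¹ with hc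
  have hcross := (differentiableOn_crossIntegral (Real.log_pos hp) hC hD hdiffa hdiffb).const_mul c
  have hboundc : ∀ w ∈ logSector d ε, ‖c * crossIntegral (Real.log p) a b w‖
      ≤ ‖c‖ * ∫ t : ℝ, ‖gaussKer (Real.log p) t‖ * (C * D) := fun w hw => by
    rw [norm_mul]
    exact mul_le_mul_of_nonneg_left (norm_crossIntegral_le (Real.log_pos hp) hC hD hw)
      (norm_nonneg _)
  have hfirst : ∀ (l : List ℚ) (f : ℂ⟦X⟧), firstBorel q (1 :: l) f = formalBorel q f :=
    fun l f => by rw [firstBorel, List.headD_cons, qRoot_one hq0]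
  have hLap₁ := hcont₁.qLaplace_continuation p
  refine ⟨⟨isOrderSeq_one, ?_, ?_⟩, ⟨isOrderSeq_one, ?_, ?_⟩, ⟨isOrderSeq_one_two, ?_, ?_⟩,
    fun x => ⟨?_, ?_, ?_, ?_⟩⟩
  · rw [hfirst]
    exact isConvergent_formalBorel_qEuler hq0.ne' a
  · rw [hfirst, tildeSeq_one, LaplaceAdmissible, qRoot_one hq0]
    exact ⟨⟨_, hconta, mem_qExpGrowth_of_bounded hq hε (hdiffa.const_mul _) hbounda⟩, trivial⟩
  · rw [hfirst]
    exact isConvergent_formalBorel_qEuler hq0.ne' b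
  · rw [hfirst, tildeSeq_one, LaplaceAdmissible, qRoot_one hq0]
    exact ⟨⟨_, hcontb, mem_qExpGrowth_of_bounded hq hε (hdiffb.const_mul _) hboundb⟩, trivial⟩
  · rw [hfirst]
    exact isConvergent_formalBorel_qEuler_mul hq a b
  · rw [hfirst, tildeSeq_one_two, LaplaceAdmissible, LaplaceAdmissible, ← hp_def, hLap₁]
    exact ⟨⟨_, hcont₁, const_mul_borelSum_mem_qExpGrowth hp hab hε hK hdiff _⟩,
      ⟨_, hcont₂, mem_qExpGrowth_of_bounded hp hε hcross hboundc⟩, trivial⟩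
  · rw [QMultisumConverges, hfirst, tildeSeq_one, IterLaplaceConverges, qRoot_one hq0,
      hconta.laplaceIntegrand_continuation]
    exact integrable_laplaceIntegrand_of_bounded hq hε (hdiffa.const_mul _) hbounda x
  · rw [QMultisumConverges, hfirst, tildeSeq_one, IterLaplaceConverges, qRoot_one hq0,
      hcontb.laplaceIntegrand_continuation]
    exact integrable_laplaceIntegrand_of_bounded hq hε (hdiffb.const_mul _) hboundb x
  · rw [QMultisumConverges, hfirst, tildeSeq_one_two, IterLaplaceConverges, IterLaplaceConverges,
      ← hp_def, hLap₁, hcont₂.laplaceIntegrand_continuation]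
    exact integrable_laplaceIntegrand_of_bounded hp hε hcross hboundc x
  · simp only [qMultisum, hfirst, tildeSeq_one, tildeSeq_one_two, iterLaplace, qRoot_one hq0,
      ← hp_def, hLap₁, hcont₂.qLaplace_continuation, hconta.qLaplace_continuation,
      hcontb.qLaplace_continuation]
    exact qLaplace_crossIntegral hp hlog hq hε hdiffa hdiffb hC hD x
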